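/- **Setting.** Let $O_i=(L_{0,i},A_{0,i},L_{1,i},A_{1,i})$, $i=1,2,\dots$, be i.i.d. with $L_0\in\mathbb R^{p_0}$, $L_1\in\mathbb R^{p_1}$ and $A_0,A_1\in\{0,1\}$. Fix sets of selected covariates $J_{00},J_{10}\subseteq\{1,\dots,p_0\}$ and $J_{11}\subseteq\{1,\dots,p_1\}$, and consider the pooled logistic treatment model $$\operatorname{logit} m_0(O;\alpha)=\alpha_{0,-1}+\sum_{k\in J_{00}}\alpha_{0,0,k}L_{0,k},\qquad \operatorname{logit} m_1(O;\alpha)=\alpha_{1,-1}+\sum_{k\in J_{10}}\alpha_{1,0,k}L_{0,k}+\sum_{k\in J_{11}}\alpha_{1,1,k}L_{1,k}+\alpha_{1,2}A_0 ,$$ with free parameter vector $\alpha$ collecting all the displayed coefficients. Write $X_0$ and $X_1$ for the vectors of regressors of the two models, each padded with zeros to the length of $\alpha$, so that $\operatorname{logit} m_\tau=X_\tau^{T}\alpha$. Suppose that the model is correct at $\alpha^*$: given $(L_{0,k})_{k\in J_{00}}$, $A_0$ is Bernoulli with mean $m_0(O;\alpha^*)$, and given $A_0$, $(L_{0,k})_{k\in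 J_{10}}$ and $(L_{1,k})_{k\in J_{11}}$, $A_1$ is Bernoulli with mean $m_1(O;\alpha^*)$. **Estimator.** Let $\gamma_1>0$ and $\lambda_{1,n}\ge 0$. Let $\tilde\alpha=\tilde\alpha^{(n)}$ be random vectors such that $\tilde\alpha_{0,0,k}$ and $\tilde\alpha_{1,0,k}$ are $\sqrt n$-consistent for $\alpha^*_{0,0,k}$ and $\alpha^*_{1,0,k}$ for each $k\in J_{00}\cap J_{10}$. Let $\hat\alpha=\hat\alpha^{(n)}$ be a random vector which, whenever a minimizer exists, is a minimizer of $$-\sum_{\tau=0}^1\sum_{i=1}^n\bigl[A_{\tau,i}\log m_\tau(O_i;\alpha)+(1-A_{\tau,i})\log\{1-m_\tau(O_i;\alpha)\}\bigr]+\lambda_{1,n}\sum_{k\in J_{00}\cap J_{10}}\frac{|\alpha_{1,0,k}-\alpha_{0,0,k}|}{|\tilde\alpha_{1,0,k}-\tilde\alpha_{0,0,k}|^{\gamma_1}} ,$$ where a term with zero denominator is $0$ if $\alpha_{1,0,k}=\alpha_{0,0,k}$ and $+\infty$ otherwise, and $0\cdot\infty=0$. **Graph.** Let $V$ be the set of the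 indices of all covariate coefficients in the model (that is, $(0,0,k)$ for $k\in J_{00}$, $(1,0,k)$ for $k\in J_{10}$ and $(1,1,k)$ for $k\in J_{11}$) and $E=\{\{(0,0,k),(1,0,k)\}:k\in J_{00}\cap J_{10}\}$. Let $\mathcal B\subseteq E$ be the set of edges with $\alpha^*_{0,0,k}=\alpha^*_{1,0,k}$, let $\mathcal B_n\subseteq E$ be the set of edges with $\hat\alpha_{0,0,k}=\hat\alpha_{1,0,k}$, and let $s_0$ be the number of connected components of $(V,\mathcal B)$. For a vector $\alpha$ let $\alpha_{\mathcal B}$ be $\alpha$ with the coordinates $(1,0,k)$ of the edges in $\mathcal B$ removed. **Regularity assumptions.** (AL1) The Fisher information $I(\alpha^*)=\sum_{\tau}E[m_\tau(1-m_\tau)X_\tau X_\tau^{T}]$, with $m_\tau=m_\tau(O;\alpha^*)$, is finite (every entry of each summand is integrable) and positive definite. (AL2) There are an open neighbourhood $U$ of $\alpha^*$ and functions $M_0,M_1$ of $O$ such that, for each $\tau$, almost surely $|\phi'''(X_\tau^{T}\alpha)|\le M_\tau$ for all $\alpha\in U$, where $\phi(t)=\log(1+e^t)$, and $E[M_\tau|X_{\tau,j}X_{\tau,k}X_{\tau,l}|]<\infty$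 for all $j,k,l$. **Theorem.** Assume in addition that $\lambda_{1,n}/\sqrt n\to0$ and $\lambda_{1,n}n^{(\gamma_1-1)/2}\to\infty$ as $n\to\infty$. Then 1. $P(\mathcal B_n=\mathcal B)\to1$; 2. the vector $\alpha_{\mathcal B}$ has dimension $s_0+3$, and $\sqrt n(\hat\alpha_{\mathcal B}-\alpha^*_{\mathcal B})$ converges in distribution to a mean-zero Gaussian distribution on $\mathbb R^{s_0+3}$. Its (positive semidefinite) covariance matrix is $H^{-1}\Sigma H^{-1}$, where $H=R^{T}I(\alpha^*)R$, $\Sigma=R^{T}E[\psi\psi^{T}]R$, $\psi=\sum_\tau(A_\tau-m_\tau(O;\alpha^*))X_\tau$, and $R$ is the $0$-$1$ matrix that recovers a full vector from its reduced vector by giving $(1,0,k)$ the value at $(0,0,k)$ for each edge in $\mathcal B$. -/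

import Mathlib

open MeasureTheory ProbabilityTheory Filter Topology
open scoped ENNReal Matrix

namespace FusedLasso

/-- One subject's record `(L₀, A₀, L₁, A₁)`: baseline covariates, first treatment,
time-one covariates, second treatment. -/
abbrev Obs (p₀ p₁ : ℕ) : Type := (Fin p₀ → ℝ) × Bool × (Fin p₁ → ℝ) × Bool

/-- The binary treatment `A_τ`, as a real number in `{0, 1}`. -/
def trt {p₀ p₁ : ℕ} (τ : Fin 2) (o : Obs p₀ p₁) : ℝ :=
  match τ with
  | 0 => if o.2.1 then 1 else 0
  | 1 => if o.2.2.2 then 1 else 0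

/-- Indices of the free coefficients of the pooled logistic treatment model after variable
selection. `J₀₀` and `J₁₀` are the components of `L₀` kept in the models for `A₀` and `A₁`, and
`J₁₁` the components of `L₁` kept in the model for `A₁`. All other covariate coefficients are
fixed at zero, so that they do not appear as indices. -/
inductive Coef {p₀ p₁ : ℕ} (J₀₀ J₁₀ : Finset (Fin p₀)) (J₁₁ : Finset (Fin p₁)) : Type
  /-- intercept of the model for `A₀` -/
  | icpt0
  /-- coefficient of `L₀ₖ` in the model for `A₀` -/
  | base0 (k : J₀₀)
  /-- intercept of the model for `A₁` -/
  | icpt1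
  /-- coefficient of `L₀ₖ` in the model for `A₁` -/
  | base1 (k : J₁₀)
  /-- coefficient of `L₁ₖ` in the model for `A₁` -/
  | cov1 (k : J₁₁)
  /-- coefficient of `A₀` in the model for `A₁` -/
  | trt1
  deriving DecidableEq, Fintype

section

variable {p₀ p₁ : ℕ} {J₀₀ J₁₀ : Finset (Fin p₀)} {J₁₁ : Finset (Fin p₁)}

/-- The regressors of the row `τ` of the pooled data. -/
def design (τ : Fin 2) (o : Obs p₀ p₁) (c : Coef J₀₀ J₁₀ J₁₁) : ℝ :=
  match τ, c with
  | 0, .icpt0 => 1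
  | 0, .base0 k => o.1 k
  | 1, .icpt1 => 1
  | 1, .base1 k => o.1 k
  | 1, .cov1 k => o.2.2.1 k
  | 1, .trt1 => trt 0 o
  | _, _ => 0

/-- The modelled treatment probability `m_τ(L₀, L₁, A₀; α)`. -/
noncomputable def prob (τ : Fin 2) (o : Obs p₀ p₁) (α : Coef J₀₀ J₁₀ J₁₁ → ℝ) : ℝ :=
  Real.sigmoid (∑ c, α c * design τ o c)

/-- The pooled negative Bernoulli log-likelihood of the first `n` subjects. -/
noncomputable def negLogLik (n : ℕ) (x : ℕ → Obs p₀ p₁) (α : Coef J₀₀ J₁₀ J₁₁ → ℝ) : ℝ :=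
  ∑ τ : Fin 2, ∑ i ∈ Finset.range n,
    -(trt τ (x i) * Real.log (prob τ (x i) α)
      + (1 - trt τ (x i)) * Real.log (1 - prob τ (x i) α))

theorem negLogLik_nonneg (n : ℕ) (x : ℕ → Obs p₀ p₁) (α : Coef J₀₀ J₁₀ J₁₁ → ℝ) :
    0 ≤ negLogLik n x α := by
  refine Finset.sum_nonneg fun τ _ => Finset.sum_nonneg fun i _ => ?_
  have h0 : 0 < prob τ (x i) α := Real.sigmoid_pos _
  have h1 : prob τ (x i) α < 1 := Real.sigmoid_lt_one _
  have l0 : Real.log (prob τ (x i) α) ≤ 0 := Real.log_nonpos h0.le h1.le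
  have l1 : Real.log (1 - prob τ (x i) α) ≤ 0 :=
    Real.log_nonpos (by linarith) (by linarith)
  have t0 : 0 ≤ trt τ (x i) := by
    unfold trt; split <;> split_ifs <;> norm_num
  have t1 : 0 ≤ 1 - trt τ (x i) := by
    unfold trt; split <;> split_ifs <;> norm_num
  nlinarith [mul_nonneg t0 (neg_nonneg.2 l0), mul_nonneg t1 (neg_nonneg.2 l1)]

/-- The index `(0, 0, k)` of a baseline covariate that was kept at both times. -/
def common0 (k : ↥(J₀₀ ∩ J₁₀)) : Coef J₀₀ J₁₀ J₁₁ :=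
  .base0 ⟨k, (Finset.mem_inter.1 k.2).1⟩

/-- The index `(1, 0, k)` of a baseline covariate that was kept at both times. -/
def common1 (k : ↥(J₀₀ ∩ J₁₀)) : Coef J₀₀ J₁₀ J₁₁ :=
  .base1 ⟨k, (Finset.mem_inter.1 k.2).2⟩

/-- The adaptive fusion penalty `∑ₖ |α₁₀ₖ - α₀₀ₖ| / |α̃₁₀ₖ - α̃₀₀ₖ| ^ γ`. Division is that of
`[0, ∞]`: if the initial estimates coincide, then the weight is infinite, and the term is `0`
when `α₁₀ₖ = α₀₀ₖ` and `∞` otherwise. -/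
noncomputable def fusionPenalty (γ : ℝ) (αinit α : Coef J₀₀ J₁₀ J₁₁ → ℝ) : ℝ≥0∞ :=
  ∑ k : ↥(J₀₀ ∩ J₁₀),
    ENNReal.ofReal |α (common1 k) - α (common0 k)|
      / ENNReal.ofReal (|αinit (common1 k) - αinit (common0 k)| ^ γ)

/-- The adaptive fused LASSO criterion, with values in `[0, ∞]`; nothing is truncated, by
`negLogLik_nonneg`. -/
noncomputable def criterion (lam γ : ℝ) (n : ℕ) (x : ℕ → Obs p₀ p₁)
    (αinit α : Coef J₀₀ J₁₀ J₁₁ → ℝ) : ℝ≥0∞ :=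
  ENNReal.ofReal (negLogLik n x α) + ENNReal.ofReal lam * fusionPenalty γ αinit α

/-- `α` is a global minimizer of the adaptive fused LASSO criterion. -/
def IsMinimizer (lam γ : ℝ) (n : ℕ) (x : ℕ → Obs p₀ p₁)
    (αinit α : Coef J₀₀ J₁₀ J₁₁ → ℝ) : Prop :=
  ∀ β : Coef J₀₀ J₁₀ J₁₁ → ℝ, criterion lam γ n x αinit α ≤ criterion lam γ n x αinit β

/-! ### The fusion graph -/

/-- The coefficients of covariates, that is all but the intercepts and the coefficient of `A₀`. -/
def IsCovariate : Coef J₀₀ J₁₀ J₁₁ → Prop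
  | .base0 _ => True
  | .base1 _ => True
  | .cov1 _ => True
  | _ => False

/-- The vertices of the fusion graph: the covariate coefficients in the model. -/
abbrev Vertex (J₀₀ J₁₀ : Finset (Fin p₀)) (J₁₁ : Finset (Fin p₁)) : Type :=
  {c : Coef J₀₀ J₁₀ J₁₁ // IsCovariate c}

/-- The fusion graph: its edges join `(0, 0, k)` and `(1, 0, k)` for the common `k`. -/
def fusionGraph (J₀₀ J₁₀ : Finset (Fin p₀)) (J₁₁ : Finset (Fin p₁)) :
    SimpleGraph (Vertex J₀₀ J₁₀ J₁₁) :=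
  SimpleGraph.fromRel fun u v => ∃ k : ↥(J₀₀ ∩ J₁₀), u.1 = common0 k ∧ v.1 = common1 k

/-- The edges of the fusion graph on whose two ends the coefficients of `α` are equal. It is `𝓑`
for the true parameter and `𝓑ₙ` for the estimator. -/
def fusedEdges (α : Coef J₀₀ J₁₀ J₁₁ → ℝ) : Set (Sym2 (Vertex J₀₀ J₁₀ J₁₁)) :=
  {e | e ∈ (fusionGraph J₀₀ J₁₀ J₁₁).edgeSet ∧ ∀ u ∈ e, ∀ v ∈ e, α u.1 = α v.1}

/-- The number of connected components of the graph `(V, 𝓑)`. -/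
noncomputable def numComponents (α : Coef J₀₀ J₁₀ J₁₁ → ℝ) : ℕ :=
  Nat.card (SimpleGraph.fromEdgeSet (fusedEdges α)).ConnectedComponent

/-! ### The reduced parameter -/

open Classical in
/-- Sends `(1, 0, k)` to `(0, 0, k)` if `k` is common and `α` takes the same value at both, and
fixes every other index. -/
noncomputable def collapse (α : Coef J₀₀ J₁₀ J₁₁ → ℝ) :
    Coef J₀₀ J₁₀ J₁₁ → Coef J₀₀ J₁₀ J₁₁
  | .base1 k =>
      if h : (k : Fin p₀) ∈ J₀₀ then
        if α (.base0 ⟨k, h⟩) = α (.base1 k) then .base0 ⟨k, h⟩ else .base1 k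
      else .base1 k
  | c => c

/-- The indices of the reduced parameter `α_𝓑`: all coefficients except the redundant `(1, 0, k)`,
those equal to their partner `(0, 0, k)`. -/
abbrev Reduced (α : Coef J₀₀ J₁₀ J₁₁ → ℝ) : Type :=
  {c : Coef J₀₀ J₁₀ J₁₁ // collapse α c = c}

/-- The 0-1 matrix of the linear map that takes a reduced parameter to the full one. -/
noncomputable def expandMatrix (α : Coef J₀₀ J₁₀ J₁₁ → ℝ) :
    Matrix (Coef J₀₀ J₁₀ J₁₁) (Reduced α) ℝ :=
  Matrix.of fun c r => if collapse α c = r.1 then 1 else 0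

/-! ### Assumptions on the distribution `P` of one record -/

/-- Given the kept components of `L₀`, `A₀` is Bernoulli with success probability `m₀(· ; α)`, and
given `A₀` and the kept components of `(L₀, L₁)`, `A₁` is Bernoulli with success probability
`m₁(· ; α)`. -/
def CorrectModel (P : Measure (Obs p₀ p₁)) (α : Coef J₀₀ J₁₀ J₁₁ → ℝ) : Prop :=
  (P[trt 0 | MeasurableSpace.comap
      (fun (o : Obs p₀ p₁) (k : J₀₀) => o.1 k) inferInstance]
    =ᵐ[P] fun o => prob 0 o α) ∧
  (P[trt 1 | MeasurableSpace.comap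
      (fun o : Obs p₀ p₁ => (o.2.1, (fun k : J₁₀ => o.1 k), fun k : J₁₁ => o.2.2.1 k))
      inferInstance]
    =ᵐ[P] fun o => prob 1 o α)

/-- The Fisher information matrix of the pooled logistic model,
`∑_τ E[m_τ (1 - m_τ) X_τ X_τᵀ]`. -/
noncomputable def fisherInfo (P : Measure (Obs p₀ p₁)) (α : Coef J₀₀ J₁₀ J₁₁ → ℝ) :
    Matrix (Coef J₀₀ J₁₀ J₁₁) (Coef J₀₀ J₁₀ J₁₁) ℝ :=
  Matrix.of fun c d => ∑ τ : Fin 2,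
    ∫ o, prob τ o α * (1 - prob τ o α) * design τ o c * design τ o d ∂P

/-- First regularity condition: the Fisher information is finite and positive definite. -/
def FisherRegular (P : Measure (Obs p₀ p₁)) (α : Coef J₀₀ J₁₀ J₁₁ → ℝ) : Prop :=
  (∀ (τ : Fin 2) (c d : Coef J₀₀ J₁₀ J₁₁), Integrable
    (fun o => prob τ o α * (1 - prob τ o α) * design τ o c * design τ o d) P) ∧
  (fisherInfo P α).PosDef

/-- Second regularity condition: on an open set around `α`, the third derivative
`m (1 - m) (1 - 2 m)` of the log-partition function `log (1 + exp t)`, taken at the linear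
predictor, is dominated by some `M`, and `E[M |X_c X_d X_e|]` is finite for all regressors
`X_c, X_d, X_e`. -/
def ThirdDerivDominated (P : Measure (Obs p₀ p₁)) (α : Coef J₀₀ J₁₀ J₁₁ → ℝ) : Prop :=
  ∃ (U : Set (Coef J₀₀ J₁₀ J₁₁ → ℝ)) (M : Fin 2 → Obs p₀ p₁ → ℝ),
    IsOpen U ∧ α ∈ U ∧
    (∀ τ : Fin 2, ∀ᵐ o ∂P, ∀ β ∈ U,
      |prob τ o β * (1 - prob τ o β) * (1 - 2 * prob τ o β)| ≤ M τ o) ∧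
    ∀ (τ : Fin 2) (c d e : Coef J₀₀ J₁₀ J₁₁), Integrable
      (fun o => M τ o * |design τ o c * design τ o d * design τ o e|) P

/-! ### The limit law -/

/-- The score of one record in the pooled model, `∑_τ (A_τ - m_τ) X_τ`. -/
noncomputable def score (o : Obs p₀ p₁) (α : Coef J₀₀ J₁₀ J₁₁ → ℝ)
    (c : Coef J₀₀ J₁₀ J₁₁) : ℝ :=
  ∑ τ : Fin 2, (trt τ o - prob τ o α) * design τ o c

/-- The second moment matrix of the score. -/
noncomputable def scoreCov (P : Measure (Obs p₀ p₁)) (α : Coef J₀₀ J₁₀ J₁₁ → ℝ) :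
    Matrix (Coef J₀₀ J₁₀ J₁₁) (Coef J₀₀ J₁₀ J₁₁) ℝ :=
  Matrix.of fun c d => ∫ o, score o α c * score o α d ∂P

/-- The covariance `H⁻¹ Σ H⁻¹`, where `H` and `Σ` are the Fisher information and the score second
moment of the pooled model in which the truly equal common coefficients are merged. -/
noncomputable def asymptoticCov (P : Measure (Obs p₀ p₁)) (α : Coef J₀₀ J₁₀ J₁₁ → ℝ) :
    Matrix (Reduced α) (Reduced α) ℝ :=
  ((expandMatrix α)ᵀ * fisherInfo P α * expandMatrix α)⁻¹
    * ((expandMatrix α)ᵀ * scoreCov P α * expandMatrix α)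
    * ((expandMatrix α)ᵀ * fisherInfo P α * expandMatrix α)⁻¹

/-- `√n (T_n - t) = O_P(1)`. -/
def IsSqrtConsistent {Ω : Type*} [MeasurableSpace Ω] (μ : Measure Ω) (T : ℕ → Ω → ℝ) (t : ℝ) :
    Prop :=
  ∀ ε : ℝ≥0∞, 0 < ε → ∃ C : ℝ, ∀ᶠ n : ℕ in atTop,
    μ {ω | C < √(n : ℝ) * |T n ω - t|} ≤ ε

end

end FusedLasso

open FusedLasso

namespace FusedLasso

section Softplus

/-- The log-partition function of the Bernoulli family. -/
noncomputable def softplus (t : ℝ) : ℝ := Real.log (1 + Real.exp t)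

theorem log_sigmoid (t : ℝ) : Real.log (Real.sigmoid t) = t - softplus t := by
  have h : Real.sigmoid t = Real.exp t / (1 + Real.exp t) := by
    rw [Real.sigmoid_def, Real.exp_neg]
    field_simp
    ring
  rw [h, Real.log_div (Real.exp_pos t).ne' (by positivity), Real.log_exp, softplus]

theorem log_one_sub_sigmoid (t : ℝ) : Real.log (1 - Real.sigmoid t) = -softplus t := by
  have h : 1 - Real.sigmoid t = (1 + Real.exp t)⁻¹ := by
    rw [← Real.sigmoid_neg, Real.sigmoid_def, neg_neg]
  rw [h, Real.log_inv, softplus]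

theorem hasDerivAt_softplus (t : ℝ) : HasDerivAt softplus (Real.sigmoid t) t := by
  have h : HasDerivAt softplus (Real.exp t / (1 + Real.exp t)) t :=
    ((Real.hasDerivAt_exp t).const_add 1).log (by positivity)
  convert h using 1
  rw [Real.sigmoid_def, Real.exp_neg]
  field_simp
  ring

theorem continuous_softplus : Continuous softplus :=
  continuous_iff_continuousAt.2 fun t => (hasDerivAt_softplus t).continuousAt

theorem convexOn_softplus : ConvexOn ℝ Set.univ softplus := by
  refine Monotone.convexOn_univ_of_deriv (fun t => (hasDerivAt_softplus t).differentiableAt) ?_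
  rw [funext fun t => (hasDerivAt_softplus t).deriv]
  exact Real.sigmoid_monotone

theorem hasDerivAt_sigmoid_mul (t : ℝ) :
    HasDerivAt (fun t => Real.sigmoid t * (1 - Real.sigmoid t))
      (Real.sigmoid t * (1 - Real.sigmoid t) * (1 - 2 * Real.sigmoid t)) t := by
  have h := Real.hasDerivAt_sigmoid t
  refine (h.mul (h.const_sub 1)).congr_deriv ?_
  ring

/-- A function vanishing at zero is bounded by a function whose derivative bounds its own. -/
theorem abs_le_of_abs_deriv_le {f f' B B' : ℝ → ℝ} (hf : ∀ t, HasDerivAt f (f' t) t)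
    (hB : ∀ t, HasDerivAt B (B' t) t) (hf0 : f 0 = 0) (hB0 : B 0 = 0)
    (h : ∀ t ∈ Set.Icc (0 : ℝ) 1, |f' t| ≤ B' t) :
    ∀ t ∈ Set.Icc (0 : ℝ) 1, |f t| ≤ B t := by
  have key : ∀ g g' : ℝ → ℝ, (∀ t, HasDerivAt g (g' t) t) → g 0 = 0 →
      (∀ t ∈ Set.Icc (0 : ℝ) 1, 0 ≤ g' t) → ∀ t ∈ Set.Icc (0 : ℝ) 1, 0 ≤ g t := by
    intro g g' hg hg0 hpos t ht
    have hm : MonotoneOn g (Set.Icc (0 : ℝ) 1) := by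
      refine monotoneOn_of_deriv_nonneg (convex_Icc 0 1)
        (fun t _ => (hg t).continuousAt.continuousWithinAt)
        (fun t _ => (hg t).differentiableAt.differentiableWithinAt) fun t ht => ?_
      rw [(hg t).deriv]
      exact hpos t (interior_subset ht)
    simpa [hg0] using hm (Set.left_mem_Icc.2 zero_le_one) ht ht.1
  intro t ht
  rw [abs_le]
  constructor
  · have := key (fun t => B t + f t) (fun t => B' t + f' t) (fun t => (hB t).add (hf t))
      (by simp [hf0, hB0]) (fun t ht => by linarith [(abs_le.1 (h t ht)).1]) t ht
    linarith
  · have := key (fun t => B t - f t) (fun t => B' t - f' t) (fun t => (hB t).sub (hf t))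
      (by simp [hf0, hB0]) (fun t ht => by linarith [(abs_le.1 (h t ht)).2]) t ht
    linarith

/-- Second order Taylor expansion of `softplus` with a bound on the third derivative. -/
theorem abs_softplus_taylor_le {x h K : ℝ}
    (hK : ∀ s ∈ Set.Icc (0 : ℝ) 1, |Real.sigmoid (x + s * h) * (1 - Real.sigmoid (x + s * h))
      * (1 - 2 * Real.sigmoid (x + s * h))| ≤ K) :
    |softplus (x + h) - softplus x - h * Real.sigmoid x
      - h ^ 2 / 2 * (Real.sigmoid x * (1 - Real.sigmoid x))| ≤ K * |h| ^ 3 / 6 := by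
  have hl : ∀ s : ℝ, HasDerivAt (fun s => x + s * h) h s := fun s => by
    simpa using ((hasDerivAt_id s).mul_const h).const_add x
  set m₁ := Real.sigmoid x with hm₁
  set m₂ := m₁ * (1 - m₁) with hm₂
  have pw : ∀ (n : ℕ) (s : ℝ), HasDerivAt (fun s : ℝ => s ^ (n + 1)) ((n + 1 : ℝ) * s ^ n) s :=
    fun n s => by simpa using hasDerivAt_pow (n + 1) s
  have h₂ := abs_le_of_abs_deriv_le
    (f := fun s => h ^ 2 * (Real.sigmoid (x + s * h) * (1 - Real.sigmoid (x + s * h)) - m₂))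
    (f' := fun s => h ^ 2 * (Real.sigmoid (x + s * h) * (1 - Real.sigmoid (x + s * h))
      * (1 - 2 * Real.sigmoid (x + s * h)) * h))
    (B := fun s => K * |h| ^ 3 * s ^ 1) (B' := fun s => K * |h| ^ 3)
    (fun s => (((hasDerivAt_sigmoid_mul _).comp s (hl s)).sub_const _).const_mul _)
    (fun s => by simpa using (pw 0 s).const_mul (K * |h| ^ 3))
    (by simp [hm₂, hm₁]) (by simp) (fun s hs => by
      rw [abs_mul, abs_mul, abs_pow]
      calc |h| ^ 2 * (_ * |h|) ≤ |h| ^ 2 * (K * |h|) := by gcongr; exact hK s hs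
        _ = K * |h| ^ 3 := by ring)
  have h₁ := abs_le_of_abs_deriv_le
    (f := fun s => h * (Real.sigmoid (x + s * h) - m₁) - h ^ 2 * m₂ * s)
    (B := fun s => K * |h| ^ 3 / 2 * s ^ 2)
    (f' := fun s => h ^ 2 * (Real.sigmoid (x + s * h) * (1 - Real.sigmoid (x + s * h)) - m₂))
    (B' := fun s => K * |h| ^ 3 * s ^ 1)
    (fun s => (((((Real.hasDerivAt_sigmoid _).comp s (hl s)).sub_const m₁).const_mul h).sub
      ((hasDerivAt_id s).const_mul (h ^ 2 * m₂))).congr_deriv (by ring))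
    (fun s => ((pw 1 s).const_mul (K * |h| ^ 3 / 2)).congr_deriv (by norm_num; ring))
    (by simp [hm₁]) (by simp) h₂
  have h₀ := abs_le_of_abs_deriv_le
    (f := fun s => softplus (x + s * h) - softplus x - h * m₁ * s - h ^ 2 * m₂ / 2 * s ^ 2)
    (B := fun s => K * |h| ^ 3 / 6 * s ^ 3)
    (f' := fun s => h * (Real.sigmoid (x + s * h) - m₁) - h ^ 2 * m₂ * s)
    (B' := fun s => K * |h| ^ 3 / 2 * s ^ 2)
    (fun s => ((((((hasDerivAt_softplus _).comp s (hl s)).sub_const _).sub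
      ((hasDerivAt_id s).const_mul (h * m₁)))).sub
      ((pw 1 s).const_mul (h ^ 2 * m₂ / 2))).congr_deriv (by norm_num; ring))
    (fun s => ((pw 2 s).const_mul (K * |h| ^ 3 / 6)).congr_deriv (by norm_num; ring))
    (by simp) (by simp) h₁
  have := h₀ 1 (Set.right_mem_Icc.2 zero_le_one)
  simp only [one_mul, one_pow, mul_one] at this
  refine le_trans (le_of_eq ?_) this
  congr 1
  ring

end Softplus

section Criterion

variable {p₀ p₁ : ℕ} {J₀₀ J₁₀ : Finset (Fin p₀)} {J₁₁ : Finset (Fin p₁)}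

theorem negLogLik_eq (n : ℕ) (x : ℕ → Obs p₀ p₁) (α : Coef J₀₀ J₁₀ J₁₁ → ℝ) :
    negLogLik n x α = ∑ τ : Fin 2, ∑ i ∈ Finset.range n,
      (softplus (∑ c, α c * design τ (x i) c)
        - trt τ (x i) * ∑ c, α c * design τ (x i) c) := by
  refine Finset.sum_congr rfl fun τ _ => Finset.sum_congr rfl fun i _ => ?_
  rw [prob, log_sigmoid, log_one_sub_sigmoid]
  ring

theorem continuous_negLogLik (n : ℕ) (x : ℕ → Obs p₀ p₁) :
    Continuous (negLogLik (J₀₀ := J₀₀) (J₁₀ := J₁₀) (J₁₁ := J₁₁) n x) := by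
  simp only [funext (negLogLik_eq (J₀₀ := J₀₀) (J₁₀ := J₁₀) (J₁₁ := J₁₁) n x)]
  have h : ∀ τ i, Continuous fun α : Coef J₀₀ J₁₀ J₁₁ → ℝ => ∑ c, α c * design τ (x i) c :=
    fun τ i => by fun_prop
  exact continuous_finsetSum _ fun τ _ => continuous_finsetSum _ fun i _ =>
    (continuous_softplus.comp (h τ i)).sub ((h τ i).const_mul _)

theorem convexOn_negLogLik (n : ℕ) (x : ℕ → Obs p₀ p₁) :
    ConvexOn ℝ Set.univ (negLogLik (J₀₀ := J₀₀) (J₁₀ := J₁₀) (J₁₁ := J₁₁) n x) := by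
  refine ⟨convex_univ, fun α _ β _ s t hs ht hst => ?_⟩
  simp only [negLogLik_eq, smul_eq_mul, Finset.mul_sum, ← Finset.sum_add_distrib]
  refine Finset.sum_le_sum fun τ _ => Finset.sum_le_sum fun i _ => ?_
  have hl : ∑ c, (s • α + t • β) c * design τ (x i) c
      = s * ∑ c, α c * design τ (x i) c + t * ∑ c, β c * design τ (x i) c := by
    simp only [Pi.add_apply, Pi.smul_apply, smul_eq_mul, add_mul, Finset.sum_add_distrib,
      Finset.mul_sum, mul_assoc]
  have hc := convexOn_softplus.2 (Set.mem_univ (∑ c, α c * design τ (x i) c))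
    (Set.mem_univ (∑ c, β c * design τ (x i) c)) hs ht hst
  simp only [smul_eq_mul] at hc
  simp only [← Finset.mul_sum, hl]
  linear_combination hc

theorem fusionPenalty_convex (γ : ℝ) (αinit α β : Coef J₀₀ J₁₀ J₁₁ → ℝ) {s t : ℝ}
    (hs : 0 ≤ s) (ht : 0 ≤ t) :
    fusionPenalty γ αinit (s • α + t • β) ≤
      ENNReal.ofReal s * fusionPenalty γ αinit α + ENNReal.ofReal t * fusionPenalty γ αinit β := by
  simp only [fusionPenalty, Finset.mul_sum, ← Finset.sum_add_distrib, div_eq_mul_inv]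
  refine Finset.sum_le_sum fun k _ => ?_
  rw [← mul_assoc, ← mul_assoc, ← add_mul]
  gcongr
  rw [← ENNReal.ofReal_mul hs, ← ENNReal.ofReal_mul ht,
    ← ENNReal.ofReal_add (by positivity) (by positivity)]
  refine ENNReal.ofReal_le_ofReal ?_
  calc |(s • α + t • β) (common1 k) - (s • α + t • β) (common0 k)|
      = |s * (α (common1 k) - α (common0 k)) + t * (β (common1 k) - β (common0 k))| := by
        congr 1; simp; ring
    _ ≤ |s * (α (common1 k) - α (common0 k))| + |t * (β (common1 k) - β (common0 k))| :=
        abs_add_le _ _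
    _ = _ := by rw [abs_mul, abs_mul, abs_of_nonneg hs, abs_of_nonneg ht]

theorem criterion_convex (lam γ : ℝ) (n : ℕ) (x : ℕ → Obs p₀ p₁)
    (αinit α β : Coef J₀₀ J₁₀ J₁₁ → ℝ) {s t : ℝ} (hs : 0 ≤ s) (ht : 0 ≤ t) (hst : s + t = 1) :
    criterion lam γ n x αinit (s • α + t • β) ≤
      ENNReal.ofReal s * criterion lam γ n x αinit α
        + ENNReal.ofReal t * criterion lam γ n x αinit β := by
  have h := (convexOn_negLogLik n x).2 (Set.mem_univ α) (Set.mem_univ β) hs ht hst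
  calc criterion lam γ n x αinit (s • α + t • β)
      ≤ ENNReal.ofReal (s * negLogLik n x α + t * negLogLik n x β) + ENNReal.ofReal lam *
        (ENNReal.ofReal s * fusionPenalty γ αinit α
          + ENNReal.ofReal t * fusionPenalty γ αinit β) := by
        unfold criterion
        gcongr
        · exact h
        · exact fusionPenalty_convex γ αinit α β hs ht
    _ = _ := by
        rw [ENNReal.ofReal_add (mul_nonneg hs (negLogLik_nonneg _ _ _))
          (mul_nonneg ht (negLogLik_nonneg _ _ _)), ENNReal.ofReal_mul hs, ENNReal.ofReal_mul ht]
        unfold criterion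
        ring

theorem lowerSemicontinuous_const_mul {X : Type*} [TopologicalSpace X] {f : X → ℝ≥0∞}
    (hf : Continuous f) (c : ℝ≥0∞) : LowerSemicontinuous fun x => c * f x := by
  have h : ∀ x, c * f x = ⨆ m : ℕ, (min c m) * f x := fun x => by
    rw [← ENNReal.iSup_mul]
    congr 1
    rw [← inf_iSup_eq, ENNReal.iSup_natCast, inf_top_eq]
  simp only [h]
  refine lowerSemicontinuous_iSup fun m => Continuous.lowerSemicontinuous ?_
  exact (ENNReal.continuous_const_mul (by simp)).comp hf

theorem lowerSemicontinuous_criterion (lam γ : ℝ) (n : ℕ) (x : ℕ → Obs p₀ p₁)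
    (αinit : Coef J₀₀ J₁₀ J₁₁ → ℝ) : LowerSemicontinuous (criterion lam γ n x αinit) := by
  unfold criterion fusionPenalty
  refine (ENNReal.continuous_ofReal.comp (continuous_negLogLik n x)).lowerSemicontinuous.add ?_
  simp only [Finset.mul_sum, div_eq_mul_inv]
  refine lowerSemicontinuous_sum fun k _ => ?_
  have := lowerSemicontinuous_const_mul (f := fun α : Coef J₀₀ J₁₀ J₁₁ → ℝ =>
    ENNReal.ofReal |α (common1 k) - α (common0 k)|)
    (ENNReal.continuous_ofReal.comp (by fun_prop))
    (ENNReal.ofReal lam * (ENNReal.ofReal (|αinit (common1 k) - αinit (common0 k)| ^ γ))⁻¹)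
  convert this using 2
  ring

/-- If the criterion is larger on a sphere than at its centre, then it has a minimizer, and all
its minimizers are in the ball. -/
theorem exists_isMinimizer_of_sphere {lam γ : ℝ} {n : ℕ} {x : ℕ → Obs p₀ p₁}
    {αinit a : Coef J₀₀ J₁₀ J₁₁ → ℝ} {r : ℝ} (hr : 0 < r)
    (h : ∀ β, ‖β - a‖ = r → criterion lam γ n x αinit a < criterion lam γ n x αinit β) :
    (∃ β, IsMinimizer lam γ n x αinit β) ∧
      ∀ β, IsMinimizer lam γ n x αinit β → ‖β - a‖ < r := by
  have out : ∀ β, r ≤ ‖β - a‖ → criterion lam γ n x αinit a < criterion lam γ n x αinit β := by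
    intro β hβ
    by_contra! hle
    have hpos : 0 < ‖β - a‖ := hr.trans_le hβ
    have ht : r / ‖β - a‖ ≤ 1 := (div_le_one hpos).2 hβ
    have ht0 : 0 ≤ r / ‖β - a‖ := by positivity
    have hc := criterion_convex lam γ n x αinit a β (sub_nonneg.2 ht) ht0 (by ring)
    have hs := h ((1 - r / ‖β - a‖) • a + (r / ‖β - a‖) • β) (by
      rw [show (1 - r / ‖β - a‖) • a + (r / ‖β - a‖) • β - a = (r / ‖β - a‖) • (β - a) by
        module, norm_smul, Real.norm_of_nonneg ht0, div_mul_cancel₀ _ hpos.ne'])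
    refine absurd (hs.trans_le hc) (not_lt.2 ?_)
    calc _ ≤ ENNReal.ofReal (1 - r / ‖β - a‖) * criterion lam γ n x αinit a
          + ENNReal.ofReal (r / ‖β - a‖) * criterion lam γ n x αinit a := by gcongr
      _ = criterion lam γ n x αinit a := by
          rw [← add_mul, ← ENNReal.ofReal_add (sub_nonneg.2 ht) ht0]
          simp
  constructor
  · obtain ⟨b, hb, hmin⟩ := LowerSemicontinuousOn.exists_isMinOn
      ⟨a, Metric.mem_closedBall_self hr.le⟩ (isCompact_closedBall a r)
      ((lowerSemicontinuous_criterion lam γ n x αinit).lowerSemicontinuousOn _)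
    refine ⟨b, fun β => ?_⟩
    by_cases hβ : β ∈ Metric.closedBall a r
    · exact hmin hβ
    · rw [Metric.mem_closedBall, dist_eq_norm, not_le] at hβ
      exact (hmin (Metric.mem_closedBall_self hr.le)).trans (out β hβ.le).le
  · intro β hβ
    by_contra! hle
    exact absurd (out β hle) (not_lt.2 (hβ a))

end Criterion

section Graph

variable {p₀ p₁ : ℕ} {J₀₀ J₁₀ : Finset (Fin p₀)} {J₁₁ : Finset (Fin p₁)}

theorem collapse_base1_of_notMem (α : Coef J₀₀ J₁₀ J₁₁ → ℝ) {k : J₁₀} (h : (k : Fin p₀) ∉ J₀₀) :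
    collapse α (.base1 k) = .base1 k := by
  simp [collapse, h]

theorem collapse_common1 (α : Coef J₀₀ J₁₀ J₁₁ → ℝ) (k : ↥(J₀₀ ∩ J₁₀)) :
    collapse α (common1 k) = if α (common1 k) = α (common0 k) then common0 k else common1 k := by
  have h : (k : Fin p₀) ∈ J₀₀ := (Finset.mem_inter.1 k.2).1
  simp only [collapse, common1, common0, h, dite_true, eq_comm]

/-- Every index is fixed by `collapse α`, or it is the redundant end of a fused edge. -/
theorem collapse_eq_self_or (α : Coef J₀₀ J₁₀ J₁₁ → ℝ) (c : Coef J₀₀ J₁₀ J₁₁) :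
    collapse α c = c ∨ ∃ k : ↥(J₀₀ ∩ J₁₀), c = common1 k ∧ α (common1 k) = α (common0 k)
      ∧ collapse α c = common0 k := by
  cases c with
  | base1 k =>
    by_cases h : (k : Fin p₀) ∈ J₀₀
    · let k' : ↥(J₀₀ ∩ J₁₀) := ⟨k, Finset.mem_inter.2 ⟨h, k.2⟩⟩
      have hk : (Coef.base1 k : Coef J₀₀ J₁₀ J₁₁) = common1 k' := rfl
      rw [hk]
      by_cases e : α (common1 k') = α (common0 k')
      · exact Or.inr ⟨k', rfl, e, by rw [collapse_common1, if_pos e]⟩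
      · exact Or.inl (by rw [collapse_common1, if_neg e])
    · exact Or.inl (collapse_base1_of_notMem α h)
  | _ => exact Or.inl rfl

theorem collapse_collapse (α : Coef J₀₀ J₁₀ J₁₁ → ℝ) (c : Coef J₀₀ J₁₀ J₁₁) :
    collapse α (collapse α c) = collapse α c := by
  rcases collapse_eq_self_or α c with h | ⟨k, -, -, h⟩
  · rw [h, h]
  · rw [h]; rfl

theorem isCovariate_collapse {α : Coef J₀₀ J₁₀ J₁₁ → ℝ} {c : Coef J₀₀ J₁₀ J₁₁}
    (hc : IsCovariate c) : IsCovariate (collapse α c) := by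
  rcases collapse_eq_self_or α c with h | ⟨k, -, -, h⟩
  · rwa [h]
  · rw [h]; trivial

/-- The edge of the fusion graph that belongs to a common covariate. -/
def fusionEdge (k : ↥(J₀₀ ∩ J₁₀)) : Sym2 (Vertex J₀₀ J₁₀ J₁₁) :=
  s(⟨common0 k, trivial⟩, ⟨common1 k, trivial⟩)

theorem common0_ne_common1 (k l : ↥(J₀₀ ∩ J₁₀)) :
    (common0 k : Coef J₀₀ J₁₀ J₁₁) ≠ common1 l := by
  simp [common0, common1]

theorem mem_edgeSet_fusionGraph (e : Sym2 (Vertex J₀₀ J₁₀ J₁₁)) :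
    e ∈ (fusionGraph J₀₀ J₁₀ J₁₁).edgeSet ↔ ∃ k, e = fusionEdge k := by
  induction e with
  | h u v =>
    simp only [SimpleGraph.mem_edgeSet, fusionGraph, SimpleGraph.fromRel_adj, fusionEdge,
      Sym2.eq_iff, Subtype.ext_iff]
    constructor
    · rintro ⟨-, ⟨k, h₁, h₂⟩ | ⟨k, h₁, h₂⟩⟩
      · exact ⟨k, Or.inl ⟨h₁, h₂⟩⟩
      · exact ⟨k, Or.inr ⟨h₂, h₁⟩⟩
    · rintro ⟨k, ⟨h₁, h₂⟩ | ⟨h₁, h₂⟩⟩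
      · exact ⟨fun h => common0_ne_common1 k k (h₁.symm.trans ((congrArg Subtype.val h).trans h₂)),
          Or.inl ⟨k, h₁, h₂⟩⟩
      · exact ⟨fun h => common0_ne_common1 k k (h₂.symm.trans ((congrArg Subtype.val h.symm).trans h₁)),
          Or.inr ⟨k, h₂, h₁⟩⟩

theorem mem_fusedEdges (α : Coef J₀₀ J₁₀ J₁₁ → ℝ) (e : Sym2 (Vertex J₀₀ J₁₀ J₁₁)) :
    e ∈ fusedEdges α ↔ ∃ k, e = fusionEdge k ∧ α (common1 k) = α (common0 k) := by
  simp only [fusedEdges, Set.mem_ofPred_eq, mem_edgeSet_fusionGraph]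
  constructor
  · rintro ⟨⟨k, rfl⟩, h⟩
    exact ⟨k, rfl, h ⟨common1 k, trivial⟩ (Sym2.mem_mk_right _ _) ⟨common0 k, trivial⟩
      (Sym2.mem_mk_left _ _)⟩
  · rintro ⟨k, rfl, h⟩
    refine ⟨⟨k, rfl⟩, fun u hu v hv => ?_⟩
    rw [fusionEdge, Sym2.mem_iff] at hu hv
    rcases hu with rfl | rfl <;> rcases hv with rfl | rfl <;> simp [h]

theorem fusedEdges_congr {α β : Coef J₀₀ J₁₀ J₁₁ → ℝ}
    (h : ∀ k : ↥(J₀₀ ∩ J₁₀), α (common1 k) = α (common0 k) ↔ β (common1 k) = β (common0 k)) :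
    fusedEdges α = fusedEdges β := by
  ext e
  simp only [mem_fusedEdges, h]

theorem collapse_eq_of_adj {α : Coef J₀₀ J₁₀ J₁₁ → ℝ} {u v : Vertex J₀₀ J₁₀ J₁₁}
    (h : (SimpleGraph.fromEdgeSet (fusedEdges α)).Adj u v) :
    collapse α u.1 = collapse α v.1 := by
  rw [SimpleGraph.fromEdgeSet_adj, mem_fusedEdges] at h
  obtain ⟨⟨k, he, hk⟩, -⟩ := h
  have h₁ : collapse α (common1 k) = common0 k := by rw [collapse_common1, if_pos hk]
  have h₀ : collapse α (common0 k) = common0 k := rfl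
  rw [fusionEdge, Sym2.eq_iff] at he
  rcases he with ⟨rfl, rfl⟩ | ⟨rfl, rfl⟩ <;> simp only [h₀, h₁]

theorem collapse_reachable (α : Coef J₀₀ J₁₀ J₁₁ → ℝ) (v : Vertex J₀₀ J₁₀ J₁₁) :
    (SimpleGraph.fromEdgeSet (fusedEdges α)).Reachable
      ⟨collapse α v.1, isCovariate_collapse v.2⟩ v := by
  obtain ⟨c, hc⟩ := v
  rcases collapse_eq_self_or α c with h | ⟨k, rfl, hk, h⟩
  · simp only [h]; exact SimpleGraph.Reachable.refl _
  · refine SimpleGraph.Adj.reachable ?_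
    rw [SimpleGraph.fromEdgeSet_adj, mem_fusedEdges]
    simp only [h]
    exact ⟨⟨k, rfl, hk⟩, fun e => common0_ne_common1 k k (congrArg Subtype.val e)⟩

/-- Each component of the graph of fused edges contains exactly one vertex that `collapse` fixes. -/
noncomputable def componentEquiv (α : Coef J₀₀ J₁₀ J₁₁ → ℝ) :
    (SimpleGraph.fromEdgeSet (fusedEdges α)).ConnectedComponent ≃
      {r : Reduced α // IsCovariate r.1} where
  toFun C := C.lift
    (fun v => ⟨⟨collapse α v.1, collapse_collapse α v.1⟩, isCovariate_collapse v.2⟩)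
    (fun u v w _ => by
      simp only [Subtype.mk.injEq]
      induction w with
      | nil => rfl
      | cons h w ih => exact (collapse_eq_of_adj h).trans (ih (by simp_all)))
  invFun r := SimpleGraph.connectedComponentMk _ ⟨r.1.1, r.2⟩
  left_inv C := by
    induction C using SimpleGraph.ConnectedComponent.ind with
    | h v => exact SimpleGraph.ConnectedComponent.sound (collapse_reachable α v)
  right_inv r := by
    obtain ⟨⟨c, hc⟩, h⟩ := r
    simp [hc]

theorem card_reduced (α : Coef J₀₀ J₁₀ J₁₁ → ℝ) :
    Fintype.card (Reduced α) = numComponents α + 3 := by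
  classical
  have h3 : Fintype.card {r : Reduced α // ¬ IsCovariate r.1} = 3 := by
    let f : Fin 3 → {r : Reduced α // ¬ IsCovariate r.1} := fun i =>
      match i with
      | 0 => ⟨⟨.icpt0, rfl⟩, id⟩
      | 1 => ⟨⟨.icpt1, rfl⟩, id⟩
      | 2 => ⟨⟨.trt1, rfl⟩, id⟩
    have hf : Function.Bijective f := by
      constructor
      · intro i j h
        fin_cases i <;> fin_cases j <;> simp_all [f, Subtype.ext_iff]
      · rintro ⟨⟨c, hc⟩, h⟩
        cases c with
        | icpt0 => exact ⟨0, rfl⟩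
        | icpt1 => exact ⟨1, rfl⟩
        | trt1 => exact ⟨2, rfl⟩
        | _ => exact absurd trivial h
    rw [← Fintype.card_of_bijective hf, Fintype.card_fin]
  rw [numComponents, Nat.card_congr (componentEquiv α), Nat.card_eq_fintype_card, ← h3,
    Fintype.card_subtype_compl]
  have := Fintype.card_subtype_le (fun r : Reduced α => IsCovariate r.1)
  omega

theorem expandMatrix_mulVec (α : Coef J₀₀ J₁₀ J₁₁ → ℝ) (v : Reduced α → ℝ)
    (c : Coef J₀₀ J₁₀ J₁₁) :
    (expandMatrix α *ᵥ v) c = v ⟨collapse α c, collapse_collapse α c⟩ := by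
  classical
  rw [Matrix.mulVec, dotProduct, Finset.sum_eq_single ⟨collapse α c, collapse_collapse α c⟩]
  · simp [expandMatrix]
  · intro r _ hr
    have : collapse α c ≠ r.1 := fun h => hr (Subtype.ext h.symm)
    simp [expandMatrix, this]
  · simp

theorem expandMatrix_mulVec_apply (α : Coef J₀₀ J₁₀ J₁₁ → ℝ) (v : Reduced α → ℝ)
    (r : Reduced α) : (expandMatrix α *ᵥ v) r.1 = v r := by
  rw [expandMatrix_mulVec]; congr 1; exact Subtype.ext r.2

theorem expandMatrix_mulVec_injective (α : Coef J₀₀ J₁₀ J₁₁ → ℝ) :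
    Function.Injective (expandMatrix α).mulVec := fun v w h => by
  ext r
  rw [← expandMatrix_mulVec_apply α v r, h, expandMatrix_mulVec_apply]

theorem expandMatrix_mulVec_comp_val (α u : Coef J₀₀ J₁₀ J₁₁ → ℝ) :
    expandMatrix α *ᵥ (fun r : Reduced α => u r.1) = fun c => u (collapse α c) := by
  ext c; rw [expandMatrix_mulVec]

/-- The coordinates removed by `collapse` are those with index `common1 k` for a fused `k`. -/
theorem abs_sub_collapse_le (α u : Coef J₀₀ J₁₀ J₁₁ → ℝ) (c : Coef J₀₀ J₁₀ J₁₁) :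
    |u c - u (collapse α c)| ≤ ∑ k : ↥(J₀₀ ∩ J₁₀),
      if α (common1 k) = α (common0 k) then |u (common1 k) - u (common0 k)| else 0 := by
  rcases collapse_eq_self_or α c with h | ⟨k, rfl, hk, h⟩
  · rw [h, sub_self, abs_zero]
    exact Finset.sum_nonneg fun k _ => by split_ifs <;> positivity
  · rw [h]
    refine le_trans (le_of_eq ?_) (Finset.single_le_sum (f := fun k : ↥(J₀₀ ∩ J₁₀) =>
      if α (common1 k) = α (common0 k) then |u (common1 k) - u (common0 k)| else 0)
      (fun k _ => by split_ifs <;> positivity) (Finset.mem_univ k))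
    simp [hk]

end Graph

section Residual

variable {Ω : Type*} {m mΩ : MeasurableSpace Ω} {P : Measure Ω} [IsProbabilityMeasure P]
  {A p X : Ω → ℝ}

theorem integral_mul_eq_of_condExp (hm : m ≤ mΩ) (hA : Integrable A P) (hcond : P[A | m] =ᵐ[P] p)
    {g : Ω → ℝ} (hg : Measurable[m] g) (hAg : Integrable (fun ω => A ω * g ω) P) :
    ∫ ω, A ω * g ω ∂P = ∫ ω, p ω * g ω ∂P := by
  have h := condExp_mul_of_stronglyMeasurable_right (μ := P) (m := m) hg.stronglyMeasurable
    (f := A) hAg hA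
  rw [← integral_condExp hm]
  refine integral_congr_ae (h.trans ?_)
  filter_upwards [hcond] with ω hω
  simp [hω]

/-- The residual of a binary variable times a regressor is square integrable if the conditional
variance times the squared regressor is integrable. -/
theorem memLp_residual (hm : m ≤ mΩ) (hA : Measurable A) (hA01 : ∀ ω, A ω = 0 ∨ A ω = 1)
    (hcond : P[A | m] =ᵐ[P] p) (hp : Measurable[m] p) (hp0 : ∀ ω, 0 ≤ p ω) (hp1 : ∀ ω, p ω ≤ 1)
    (hX : Measurable[m] X) (hint : Integrable (fun ω => p ω * (1 - p ω) * X ω * X ω) P) :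
    MemLp (fun ω => (A ω - p ω) * X ω) 2 P := by
  have hp' : Measurable p := hp.mono hm le_rfl
  have hX' : Measurable X := hX.mono hm le_rfl
  have hAb : ∀ ω, |A ω| ≤ 1 := fun ω => by rcases hA01 ω with h | h <;> simp [h]
  have hAi : Integrable A P := Integrable.of_bound hA.aestronglyMeasurable 1 (ae_of_all _ hAb)
  rw [memLp_two_iff_integrable_sq (by fun_prop)]
  let Z : ℕ → Ω → ℝ := fun K ω => min (X ω ^ 2) K
  have hZ0 : ∀ K ω, 0 ≤ Z K ω := fun K ω => le_min (sq_nonneg _) (Nat.cast_nonneg K)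
  have hZm : ∀ K, Measurable[m] (Z K) := fun K => (hX.pow_const 2).min measurable_const
  have hZm' : ∀ K, Measurable (Z K) := fun K => (hZm K).mono hm le_rfl
  have hZK : ∀ K ω, |Z K ω| ≤ K := fun K ω => by
    rw [abs_of_nonneg (hZ0 K ω)]; exact min_le_right _ _
  set C := ∫ ω, p ω * (1 - p ω) * X ω * X ω ∂P with hC
  have bdd : ∀ (f : Ω → ℝ), Measurable f → (∀ ω, |f ω| ≤ 1) → ∀ K,
      Integrable (fun ω => f ω * Z K ω) P := fun f hf hf1 K =>
    Integrable.of_bound (hf.mul (hZm' K)).aestronglyMeasurable K (ae_of_all _ fun ω => by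
      rw [Real.norm_eq_abs, abs_mul]
      calc |f ω| * |Z K ω| ≤ 1 * K :=
            mul_le_mul (hf1 ω) (hZK K ω) (abs_nonneg _) zero_le_one
        _ = K := one_mul _)
  have step : ∀ K, ∫ ω, (A ω - p ω) ^ 2 * Z K ω ∂P ≤ C := by
    intro K
    have h1 : Integrable (fun ω => A ω * ((1 - 2 * p ω) * Z K ω)) P := by
      refine (bdd (fun ω => A ω * (1 - 2 * p ω)) (by fun_prop) (fun ω => ?_) K).congr
        (ae_of_all _ fun ω => by ring)
      rw [abs_mul]
      exact mul_le_one₀ (hAb ω) (abs_nonneg _)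
        (abs_le.2 ⟨by linarith [hp1 ω], by linarith [hp0 ω]⟩)
    have h2 : Integrable (fun ω => p ω ^ 2 * Z K ω) P :=
      bdd _ (by fun_prop) (fun ω => by
        rw [abs_of_nonneg (sq_nonneg _)]; exact pow_le_one₀ (hp0 ω) (hp1 ω)) K
    have h3 : Integrable (fun ω => p ω * ((1 - 2 * p ω) * Z K ω)) P := by
      refine (bdd (fun ω => p ω * (1 - 2 * p ω)) (by fun_prop) (fun ω => ?_) K).congr
        (ae_of_all _ fun ω => by ring)
      rw [abs_mul]
      exact mul_le_one₀ (by rw [abs_of_nonneg (hp0 ω)]; exact hp1 ω) (abs_nonneg _)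
        (abs_le.2 ⟨by linarith [hp1 ω], by linarith [hp0 ω]⟩)
    calc ∫ ω, (A ω - p ω) ^ 2 * Z K ω ∂P
        = ∫ ω, (A ω * ((1 - 2 * p ω) * Z K ω) + p ω ^ 2 * Z K ω) ∂P := by
          refine integral_congr_ae (ae_of_all _ fun ω => ?_)
          rcases hA01 ω with h | h <;> simp only [h] <;> ring
      _ = ∫ ω, (p ω * ((1 - 2 * p ω) * Z K ω) + p ω ^ 2 * Z K ω) ∂P := by
          rw [integral_add h1 h2, integral_add h3 h2,
            integral_mul_eq_of_condExp hm hAi hcond (g := fun ω => (1 - 2 * p ω) * Z K ω)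
              ((measurable_const.sub (hp.const_mul 2)).mul (hZm K)) h1]
      _ ≤ C := by
          refine integral_mono (h3.add h2) hint fun ω => ?_
          have hZX : Z K ω ≤ X ω ^ 2 := min_le_left _ _
          have hv : 0 ≤ p ω * (1 - p ω) := mul_nonneg (hp0 ω) (sub_nonneg.2 (hp1 ω))
          nlinarith [mul_le_mul_of_nonneg_left hZX hv]
  refine ⟨by fun_prop, ?_⟩
  rw [hasFiniteIntegral_iff_ofReal (ae_of_all _ fun ω => sq_nonneg _)]
  have hlim : ∀ ω, ENNReal.ofReal (((A ω - p ω) * X ω) ^ 2)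
      = liminf (fun K => ENNReal.ofReal ((A ω - p ω) ^ 2 * Z K ω)) atTop := by
    intro ω
    refine (Tendsto.liminf_eq ?_).symm
    refine tendsto_const_nhds.congr' ?_
    filter_upwards [eventually_ge_atTop ⌈X ω ^ 2⌉₊] with K hK
    have : Z K ω = X ω ^ 2 := min_eq_left ((Nat.le_ceil _).trans (Nat.cast_le.2 hK))
    rw [this, mul_pow]
  calc ∫⁻ ω, ENNReal.ofReal (((A ω - p ω) * X ω) ^ 2) ∂P
      = ∫⁻ ω, liminf (fun K => ENNReal.ofReal ((A ω - p ω) ^ 2 * Z K ω)) atTop ∂P :=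
        lintegral_congr hlim
    _ ≤ liminf (fun K => ∫⁻ ω, ENNReal.ofReal ((A ω - p ω) ^ 2 * Z K ω) ∂P) atTop :=
        lintegral_liminf_le fun K => (((hA.sub hp').pow_const 2).mul (hZm' K)).ennreal_ofReal
    _ ≤ liminf (fun _ : ℕ => ENNReal.ofReal C) atTop := by
        refine liminf_le_liminf (Eventually.of_forall fun K => ?_)
        rw [← ofReal_integral_eq_lintegral_ofReal]
        · exact ENNReal.ofReal_le_ofReal (step K)
        · refine bdd (fun ω => (A ω - p ω) ^ 2) (by fun_prop) (fun ω => ?_) K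
          rw [abs_of_nonneg (sq_nonneg _)]
          rcases hA01 ω with h | h <;> rw [h] <;> nlinarith [hp0 ω, hp1 ω]
        · exact ae_of_all _ fun ω => mul_nonneg (sq_nonneg _) (hZ0 K ω)
    _ < ⊤ := by simp

theorem integral_residual (hm : m ≤ mΩ) (hA : Measurable A) (hA01 : ∀ ω, A ω = 0 ∨ A ω = 1)
    (hcond : P[A | m] =ᵐ[P] p) (hp : Measurable[m] p) (hp0 : ∀ ω, 0 ≤ p ω) (hp1 : ∀ ω, p ω ≤ 1)
    (hX : Measurable[m] X) (hint : Integrable (fun ω => p ω * (1 - p ω) * X ω * X ω) P) :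
    ∫ ω, (A ω - p ω) * X ω ∂P = 0 := by
  have hp' : Measurable p := hp.mono hm le_rfl
  have hX' : Measurable X := hX.mono hm le_rfl
  have hAb : ∀ ω, |A ω| ≤ 1 := fun ω => by rcases hA01 ω with h | h <;> simp [h]
  have hAi : Integrable A P := Integrable.of_bound hA.aestronglyMeasurable 1 (ae_of_all _ hAb)
  have hR : Integrable (fun ω => (A ω - p ω) * X ω) P :=
    (memLp_residual hm hA hA01 hcond hp hp0 hp1 hX hint).integrable (by norm_num)
  have hpi : Integrable p P := Integrable.of_bound hp'.aestronglyMeasurable 1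
    (ae_of_all _ fun ω => by rw [Real.norm_eq_abs, abs_of_nonneg (hp0 ω)]; exact hp1 ω)
  have h0 : P[fun ω => A ω - p ω | m] =ᵐ[P] 0 := by
    refine (condExp_sub hAi hpi m).trans ?_
    rw [condExp_of_stronglyMeasurable hm hp.stronglyMeasurable hpi]
    filter_upwards [hcond] with ω hω
    simp [hω]
  exact (integral_mul_eq_of_condExp hm (hAi.sub hpi) h0 hX hR).trans (by simp)

end Residual

section Score

variable {p₀ p₁ : ℕ} {J₀₀ J₁₀ : Finset (Fin p₀)} {J₁₁ : Finset (Fin p₁)}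
  {P : Measure (Obs p₀ p₁)} {α : Coef J₀₀ J₁₀ J₁₁ → ℝ}

theorem trt_eq (τ : Fin 2) (o : Obs p₀ p₁) : trt τ o = 0 ∨ trt τ o = 1 := by
  unfold trt; split <;> split_ifs <;> simp

theorem measurable_trt (τ : Fin 2) : Measurable (trt τ : Obs p₀ p₁ → ℝ) := by
  have hb : Measurable fun b : Bool => if b then (1 : ℝ) else 0 := measurable_of_finite _
  fin_cases τ
  · exact hb.comp (measurable_fst.comp measurable_snd)
  · exact hb.comp (measurable_snd.comp (measurable_snd.comp measurable_snd))

/-- The variables on which the model for `A_τ` conditions. -/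
abbrev history (J₀₀ J₁₀ : Finset (Fin p₀)) (J₁₁ : Finset (Fin p₁)) (τ : Fin 2) :
    MeasurableSpace (Obs p₀ p₁) :=
  match τ with
  | 0 => MeasurableSpace.comap (fun (o : Obs p₀ p₁) (k : J₀₀) => o.1 k) inferInstance
  | 1 => MeasurableSpace.comap
      (fun o : Obs p₀ p₁ => (o.2.1, (fun k : J₁₀ => o.1 k), fun k : J₁₁ => o.2.2.1 k))
      inferInstance

theorem history_le (τ : Fin 2) :
    history J₀₀ J₁₀ J₁₁ τ ≤ (inferInstance : MeasurableSpace (Obs p₀ p₁)) := by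
  fin_cases τ
  · exact Measurable.comap_le (by fun_prop)
  · exact Measurable.comap_le (by fun_prop)

theorem measurable_design (τ : Fin 2) (c : Coef J₀₀ J₁₀ J₁₁) :
    Measurable[history J₀₀ J₁₀ J₁₁ τ] fun o : Obs p₀ p₁ => design τ o c := by
  have hb : Measurable fun b : Bool => if b then (1 : ℝ) else 0 := measurable_of_finite _
  fin_cases τ
  · have h := comap_measurable (m := MeasurableSpace.pi)
      fun (o : Obs p₀ p₁) (k : J₀₀) => o.1 k
    cases c with
    | base0 k => exact (measurable_pi_apply k).comp h
    | _ => exact measurable_const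
  · have h := comap_measurable (m := Prod.instMeasurableSpace) fun o : Obs p₀ p₁ =>
      (o.2.1, (fun k : J₁₀ => o.1 k), fun k : J₁₁ => o.2.2.1 k)
    cases c with
    | base1 k => exact (measurable_pi_apply k).comp ((measurable_fst.comp measurable_snd).comp h)
    | cov1 k => exact (measurable_pi_apply k).comp ((measurable_snd.comp measurable_snd).comp h)
    | trt1 =>
      have hf : Measurable fun y : Bool × (J₁₀ → ℝ) × (J₁₁ → ℝ) => if y.1 then (1 : ℝ) else 0 :=
        hb.comp measurable_fst
      exact hf.comp h
    | _ => exact measurable_const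

theorem measurable_prob (τ : Fin 2) (α : Coef J₀₀ J₁₀ J₁₁ → ℝ) :
    Measurable[history J₀₀ J₁₀ J₁₁ τ] fun o : Obs p₀ p₁ => prob τ o α := by
  refine continuous_sigmoid.measurable.comp ?_
  exact Finset.measurable_sum _ fun c _ => (measurable_design τ c).const_mul _

theorem CorrectModel.condExp_trt (h : CorrectModel P α) (τ : Fin 2) :
    P[trt τ | history J₀₀ J₁₀ J₁₁ τ] =ᵐ[P] fun o => prob τ o α := by
  fin_cases τ
  · exact h.1
  · exact h.2

theorem memLp_score [IsProbabilityMeasure P] (hmodel : CorrectModel P α) (hfisher : FisherRegular P α)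
    (c : Coef J₀₀ J₁₀ J₁₁) : MemLp (fun o => score o α c) 2 P :=
  memLp_finsetSum _ fun τ _ => memLp_residual (history_le τ) (measurable_trt τ) (trt_eq τ)
    (hmodel.condExp_trt τ) (measurable_prob τ α) (fun _ => Real.sigmoid_nonneg _)
    (fun _ => Real.sigmoid_le_one _) (measurable_design τ c) (hfisher.1 τ c c)

theorem integral_score [IsProbabilityMeasure P] (hmodel : CorrectModel P α) (hfisher : FisherRegular P α)
    (c : Coef J₀₀ J₁₀ J₁₁) : ∫ o, score o α c ∂P = 0 := by
  unfold score
  rw [integral_finsetSum _ fun τ _ => (memLp_residual (history_le τ) (measurable_trt τ) (trt_eq τ)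
    (hmodel.condExp_trt τ) (measurable_prob τ α) (fun _ => Real.sigmoid_nonneg _)
    (fun _ => Real.sigmoid_le_one _) (measurable_design τ c)
    (hfisher.1 τ c c)).integrable (by norm_num)]
  exact Finset.sum_eq_zero fun τ _ => integral_residual (history_le τ) (measurable_trt τ)
    (trt_eq τ) (hmodel.condExp_trt τ) (measurable_prob τ α) (fun _ => Real.sigmoid_nonneg _)
    (fun _ => Real.sigmoid_le_one _) (measurable_design τ c) (hfisher.1 τ c c)

theorem measurable_score (α : Coef J₀₀ J₁₀ J₁₁ → ℝ) (c : Coef J₀₀ J₁₀ J₁₁) :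
    Measurable fun o : Obs p₀ p₁ => score o α c :=
  Finset.measurable_sum _ fun τ _ =>
    ((measurable_trt τ).sub ((measurable_prob τ α).mono (history_le τ) le_rfl)).mul
      ((measurable_design τ c).mono (history_le τ) le_rfl)

end Score

section CentralLimit

variable {Ω : Type*} [MeasurableSpace Ω] {μ : Measure Ω}
  {E : Type*} [MeasurableSpace E] {P : Measure E}
  {O : ℕ → Ω → E} {ι : Type*} [Fintype ι]

theorem identDistrib_comp (hOmeas : ∀ i, Measurable (O i)) (hOlaw : ∀ i, μ.map (O i) = P)
    {g : E → ℝ} (hg : AEMeasurable g P) (i : ℕ) :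
    IdentDistrib (fun ω => g (O i ω)) (fun ω => g (O 0 ω)) μ μ := by
  have h : IdentDistrib (O i) (O 0) μ μ :=
    ⟨(hOmeas i).aemeasurable, (hOmeas 0).aemeasurable, by rw [hOlaw, hOlaw]⟩
  exact h.comp_of_aemeasurable (by rwa [hOlaw])

theorem integral_sum_sq {ξ : ι → E → ℝ} (hξ : ∀ a, MemLp (ξ a) 2 P) (x : ι → ℝ) :
    ∫ o, (∑ a, x a * ξ a o) ^ 2 ∂P = x ⬝ᵥ ((Matrix.of fun a b => ∫ o, ξ a o * ξ b o ∂P) *ᵥ x) := by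
  have hi : ∀ a b, Integrable (fun o => x a * ξ a o * (x b * ξ b o)) P := fun a b =>
    ((hξ a).const_mul (x a)).integrable_mul ((hξ b).const_mul (x b))
  simp only [sq, Finset.sum_mul_sum]
  rw [integral_finsetSum _ fun a _ => integrable_finsetSum _ fun b _ => hi a b]
  simp only [dotProduct, Matrix.mulVec, Matrix.of_apply, Finset.mul_sum]
  refine Finset.sum_congr rfl fun a _ => ?_
  rw [integral_finsetSum _ fun b _ => hi a b]
  refine Finset.sum_congr rfl fun b _ => ?_
  rw [show (fun o => x a * ξ a o * (x b * ξ b o)) = fun o => x a * x b * (ξ a o * ξ b o) from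
    funext fun o => by ring, integral_const_mul]
  ring

theorem posSemidef_second_moment {ξ : ι → E → ℝ} (hξ : ∀ a, MemLp (ξ a) 2 P) :
    (Matrix.of fun a b => ∫ o, ξ a o * ξ b o ∂P).PosSemidef := by
  refine Matrix.PosSemidef.of_dotProduct_mulVec_nonneg ?_ fun x => ?_
  · ext a b
    simp [Matrix.conjTranspose_apply, mul_comm]
  · rw [star_trivial, ← integral_sum_sq hξ]
    exact integral_nonneg fun o => sq_nonneg _

/-- Central limit theorem for centred vectors with finite second moments. -/
theorem tendstoInDistribution_multivariate [IsProbabilityMeasure μ] [IsProbabilityMeasure P]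
    [DecidableEq ι] (hOmeas : ∀ i, Measurable (O i))
    (hOindep : iIndepFun O μ) (hOlaw : ∀ i, μ.map (O i) = P)
    {ξ : ι → E → ℝ} (hξm : ∀ a, Measurable (ξ a)) (hξ : ∀ a, MemLp (ξ a) 2 P)
    (hξ0 : ∀ a, ∫ o, ξ a o ∂P = 0) :
    TendstoInDistribution
      (fun (n : ℕ) ω => WithLp.toLp 2 fun a => (√(n : ℝ))⁻¹ * ∑ i ∈ Finset.range n, ξ a (O i ω))
      atTop (id : EuclideanSpace ℝ ι → EuclideanSpace ℝ ι) (fun _ => μ)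
      (multivariateGaussian 0 (Matrix.of fun a b => ∫ o, ξ a o * ξ b o ∂P)) := by
  set S : Matrix ι ι ℝ := Matrix.of fun a b => ∫ o, ξ a o * ξ b o ∂P with hS
  have hpsd : S.PosSemidef := posSemidef_second_moment hξ
  have hYm : ∀ n : ℕ, Measurable fun ω => (WithLp.toLp 2 fun a =>
      (√(n : ℝ))⁻¹ * ∑ i ∈ Finset.range n, ξ a (O i ω) : EuclideanSpace ℝ ι) := fun n => by
    refine (WithLp.measurable_toLp 2 _).comp (measurable_pi_lambda _ fun a => ?_)
    exact (Finset.measurable_sum _ fun i _ => (hξm a).comp (hOmeas i)).const_mul _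
  refine ⟨fun n => (hYm n).aemeasurable, aemeasurable_id, ?_⟩
  refine ProbabilityMeasure.tendsto_of_tendsto_charFun fun t => ?_
  simp only [ProbabilityMeasure.coe_mk, Measure.map_id]
  let g : E → ℝ := fun o => ∑ a, t a * ξ a o
  have hgm : Measurable g := Finset.measurable_sum _ fun a _ => (hξm a).const_mul _
  have hg2 : MemLp g 2 P := memLp_finsetSum _ fun a _ => (hξ a).const_mul _
  have hg0 : ∫ o, g o ∂P = 0 := by
    rw [integral_finsetSum _ fun a _ => ((hξ a).integrable (by norm_num)).const_mul _]
    exact Finset.sum_eq_zero fun a _ => by rw [integral_const_mul, hξ0, mul_zero]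
  have hX0 : ∀ f : E → ℝ, Measurable f → ∫ ω, f (O 0 ω) ∂μ = ∫ o, f o ∂P := fun f hf => by
    rw [← hOlaw 0, integral_map (hOmeas 0).aemeasurable hf.aestronglyMeasurable]
  have hXmem : MemLp (fun ω => g (O 0 ω)) 2 μ := by
    have := hg2
    rw [← hOlaw 0] at this
    exact (memLp_map_measure_iff hgm.aestronglyMeasurable (hOmeas 0).aemeasurable).1 this
  have hmean : μ[fun ω => g (O 0 ω)] = 0 := (hX0 g hgm).trans hg0
  have hvar : Var[fun ω => g (O 0 ω); μ] = t ⬝ᵥ S *ᵥ t := by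
    refine (variance_of_integral_eq_zero (hgm.comp (hOmeas 0)).aemeasurable hmean).trans ?_
    exact (hX0 (fun o => g o ^ 2) (hgm.pow_const 2)).trans (integral_sum_sq hξ t)
  have clt := tendstoInDistribution_inv_sqrt_mul_sum_sub (P := μ)
    (X := fun i ω => g (O i ω)) (Y := id)
    (P' := gaussianReal 0 Var[fun ω => g (O 0 ω); μ].toNNReal) ⟨by fun_prop, by simp⟩ hXmem
    (hOindep.comp (fun _ => g) fun _ => hgm)
    (fun i => identDistrib_comp hOmeas hOlaw hgm.aemeasurable i)
  have hc := (ProbabilityMeasure.tendsto_iff_tendsto_charFun.1 clt.tendsto) 1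
  simp only [ProbabilityMeasure.coe_mk, Measure.map_id] at hc
  rw [charFun_multivariateGaussian hpsd]
  rw [charFun_gaussianReal] at hc
  convert hc using 1
  · ext n
    rw [charFun_apply, charFun_apply, integral_map (hYm n).aemeasurable (by fun_prop),
      integral_map (clt.forall_aemeasurable n) (by fun_prop)]
    refine integral_congr_ae (ae_of_all _ fun ω => ?_)
    simp only [hmean, mul_zero, sub_zero]
    congr 3
    simp only [g, PiLp.inner_apply, RCLike.inner_apply, conj_trivial, one_mul]
    rw [Finset.sum_comm, Finset.mul_sum]
    refine Finset.sum_congr rfl fun a _ => ?_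
    rw [← Finset.mul_sum]
    ring
  · rw [hvar]
    have hnn : 0 ≤ t ⬝ᵥ S *ᵥ t := by simpa using hpsd.dotProduct_mulVec_nonneg (t : ι → ℝ)
    simp [Real.coe_toNNReal _ hnn]

theorem tendsto_average [IsProbabilityMeasure μ] (hOmeas : ∀ i, Measurable (O i)) (hOindep : iIndepFun O μ)
    (hOlaw : ∀ i, μ.map (O i) = P) {g : E → ℝ} (hg : Integrable g P) :
    ∀ᵐ ω ∂μ, Tendsto (fun n : ℕ => (∑ i ∈ Finset.range n, g (O i ω)) / n) atTop
      (𝓝 (∫ o, g o ∂P)) := by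
  obtain ⟨g', hg'm, hgg'⟩ := hg.aestronglyMeasurable
  have hg'm : Measurable g' := hg'm.measurable
  have hg' : Integrable g' P := hg.congr hgg'
  have hae : ∀ᵐ ω ∂μ, ∀ i, g (O i ω) = g' (O i ω) := by
    rw [ae_all_iff]
    intro i
    have := hgg'
    rw [← hOlaw i] at this
    exact ae_of_ae_map (hOmeas i).aemeasurable this
  have h := strong_law_ae_real (μ := μ) (fun i ω => g' (O i ω))
    (by
      have := hg'
      rw [← hOlaw 0] at this
      exact this.comp_measurable (hOmeas 0))
    (fun i j hij => (hOindep.indepFun hij).comp hg'm hg'm)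
    (fun i => identDistrib_comp hOmeas hOlaw hg'm.aemeasurable i)
  filter_upwards [h, hae] with ω hω hae
  simp only [hae]
  convert hω using 2
  rw [integral_congr_ae hgg', ← hOlaw 0,
    integral_map (hOmeas 0).aemeasurable hg'm.aestronglyMeasurable]

/-- Normalized sums of centred variables are bounded in probability. -/
theorem measure_normalized_sum_ge_le [IsProbabilityMeasure μ] (hOmeas : ∀ i, Measurable (O i)) (hOindep : iIndepFun O μ)
    (hOlaw : ∀ i, μ.map (O i) = P) {g : E → ℝ} (hgm : Measurable g) (hg : MemLp g 2 P)
    (hg0 : ∫ o, g o ∂P = 0) {K : ℝ} (hK : 0 < K) {n : ℕ} (hn : 0 < n) :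
    μ {ω | K ≤ |(√(n : ℝ))⁻¹ * ∑ i ∈ Finset.range n, g (O i ω)|}
      ≤ ENNReal.ofReal (Var[g; P] / K ^ 2) := by
  have hmem : ∀ i, MemLp (fun ω => g (O i ω)) 2 μ := fun i => by
    have := hg
    rw [← hOlaw i] at this
    exact (memLp_map_measure_iff hgm.aestronglyMeasurable (hOmeas i).aemeasurable).1 this
  have hmean : ∀ i, ∫ ω, g (O i ω) ∂μ = 0 := fun i => by
    rw [← hg0, ← hOlaw i, integral_map (hOmeas i).aemeasurable hgm.aestronglyMeasurable]
  have hvar : ∀ i, Var[fun ω => g (O i ω); μ] = Var[g; P] := fun i => by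
    rw [← hOlaw i, variance_map hgm.aemeasurable (hOmeas i).aemeasurable]
    rfl
  have hs : MemLp (fun ω => (√(n : ℝ))⁻¹ * ∑ i ∈ Finset.range n, g (O i ω)) 2 μ :=
    (memLp_finsetSum _ fun i _ => hmem i).const_mul _
  have hE : μ[fun ω => (√(n : ℝ))⁻¹ * ∑ i ∈ Finset.range n, g (O i ω)] = 0 := by
    rw [integral_const_mul, integral_finsetSum _ fun i _ => (hmem i).integrable (by norm_num)]
    simp [hmean]
  have h := meas_ge_le_variance_div_sq hs hK
  simp only [hE, sub_zero] at h
  refine h.trans (ENNReal.ofReal_le_ofReal ?_)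
  have hv : Var[fun ω => ∑ i ∈ Finset.range n, g (O i ω); μ] = n * Var[g; P] := by
    have := IndepFun.variance_sum (μ := μ) (X := fun i ω => g (O i ω)) (s := Finset.range n)
      (fun i _ => hmem i)
      (fun i _ j _ hij => (hOindep.indepFun hij).comp hgm hgm)
    simp only [hvar, Finset.sum_const, Finset.card_range, nsmul_eq_mul] at this
    rw [← this]
    congr 1
    ext ω
    simp
  have hn' : (0 : ℝ) < n := Nat.cast_pos.2 hn
  rw [variance_const_mul, hv, inv_pow, Real.sq_sqrt hn'.le, inv_mul_cancel_left₀ hn'.ne']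

end CentralLimit

section Oracle

variable {p₀ p₁ : ℕ} {J₀₀ J₁₀ : Finset (Fin p₀)} {J₁₁ : Finset (Fin p₁)}

/-- The difference of the two coefficients of a common covariate. -/
def gap (u : Coef J₀₀ J₁₀ J₁₁ → ℝ) (k : ↥(J₀₀ ∩ J₁₀)) : ℝ := u (common1 k) - u (common0 k)

theorem gap_add (u v : Coef J₀₀ J₁₀ J₁₁ → ℝ) (k : ↥(J₀₀ ∩ J₁₀)) :
    gap (u + v) k = gap u k + gap v k := by
  simp only [gap, Pi.add_apply]; ring

theorem gap_smul (s : ℝ) (u : Coef J₀₀ J₁₀ J₁₁ → ℝ) (k : ↥(J₀₀ ∩ J₁₀)) :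
    gap (s • u) k = s * gap u k := by
  simp only [gap, Pi.smul_apply, smul_eq_mul]; ring

theorem abs_gap_le (u : Coef J₀₀ J₁₀ J₁₁ → ℝ) (k : ↥(J₀₀ ∩ J₁₀)) : |gap u k| ≤ 2 * ‖u‖ := by
  have h₁ := norm_le_pi_norm u (common1 k)
  have h₀ := norm_le_pi_norm u (common0 k)
  calc |gap u k| ≤ |u (common1 k)| + |u (common0 k)| := abs_sub _ _
    _ ≤ 2 * ‖u‖ := by rw [Real.norm_eq_abs] at h₁ h₀; linarith

theorem le_criterion {lam γ : ℝ} (hlam : 0 < lam) {n : ℕ} {x : ℕ → Obs p₀ p₁}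
    {αinit : Coef J₀₀ J₁₀ J₁₁ → ℝ} {c : ↥(J₀₀ ∩ J₁₀) → ℝ} (hc0 : ∀ k, 0 ≤ c k)
    (hc : ∀ k, c k * |gap αinit k| ^ γ ≤ lam) (β : Coef J₀₀ J₁₀ J₁₁ → ℝ) :
    ENNReal.ofReal (negLogLik n x β + ∑ k, c k * |gap β k|) ≤ criterion lam γ n x αinit β := by
  have h0 : ∀ k, 0 ≤ c k * |gap β k| := fun k => mul_nonneg (hc0 k) (abs_nonneg _)
  rw [ENNReal.ofReal_add (negLogLik_nonneg _ _ _) (Finset.sum_nonneg fun k _ => h0 k),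
    ENNReal.ofReal_sum_of_nonneg fun k _ => h0 k]
  unfold criterion fusionPenalty
  rw [Finset.mul_sum]
  gcongr with k
  change _ ≤ ENNReal.ofReal lam * (ENNReal.ofReal |gap β k| / ENNReal.ofReal (|gap αinit k| ^ γ))
  have hW : 0 ≤ |gap αinit k| ^ γ := by positivity
  rcases hW.eq_or_lt with hW | hW
  · rw [← hW, ENNReal.ofReal_zero]
    rcases eq_or_ne (gap β k) 0 with hd | hd
    · simp [hd]
    · rw [ENNReal.div_zero (by simpa using hd), ENNReal.mul_top (by simpa using hlam)]
      exact le_top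
  · rw [← ENNReal.ofReal_div_of_pos hW, ← ENNReal.ofReal_mul hlam.le]
    refine ENNReal.ofReal_le_ofReal ?_
    rw [← mul_div_assoc, le_div_iff₀ hW]
    nlinarith [mul_le_mul_of_nonneg_right (hc k) (abs_nonneg (gap β k))]

theorem criterion_le {lam γ : ℝ} (hlam : 0 ≤ lam) {n : ℕ} {x : ℕ → Obs p₀ p₁}
    {αinit : Coef J₀₀ J₁₀ J₁₁ → ℝ} {c : ↥(J₀₀ ∩ J₁₀) → ℝ} (hc0 : ∀ k, 0 ≤ c k)
    {β : Coef J₀₀ J₁₀ J₁₁ → ℝ}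
    (hc : ∀ k, gap β k = 0 ∨ 0 < |gap αinit k| ^ γ ∧ c k * |gap αinit k| ^ γ = lam) :
    criterion lam γ n x αinit β ≤ ENNReal.ofReal (negLogLik n x β + ∑ k, c k * |gap β k|) := by
  have h0 : ∀ k, 0 ≤ c k * |gap β k| := fun k => mul_nonneg (hc0 k) (abs_nonneg _)
  rw [ENNReal.ofReal_add (negLogLik_nonneg _ _ _) (Finset.sum_nonneg fun k _ => h0 k),
    ENNReal.ofReal_sum_of_nonneg fun k _ => h0 k]
  unfold criterion fusionPenalty
  rw [Finset.mul_sum]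
  gcongr with k
  change ENNReal.ofReal lam * (ENNReal.ofReal |gap β k| / ENNReal.ofReal (|gap αinit k| ^ γ)) ≤ _
  rcases hc k with hd | ⟨hW, he⟩
  · simp [hd]
  · rw [← ENNReal.ofReal_div_of_pos hW, ← ENNReal.ofReal_mul hlam]
    refine ENNReal.ofReal_le_ofReal ?_
    rw [← mul_div_assoc, div_le_iff₀ hW, ← he]
    exact le_of_eq (by ring)

theorem quadratic_add_sub {κ : Type*} [Fintype κ] {I : Matrix κ κ ℝ} (hI : Iᵀ = I)
    (S v w : κ → ℝ) :
    (1 / 2 * ((v + w) ⬝ᵥ I *ᵥ (v + w)) - S ⬝ᵥ (v + w)) - (1 / 2 * (v ⬝ᵥ I *ᵥ v) - S ⬝ᵥ v)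
      = 1 / 2 * (w ⬝ᵥ I *ᵥ w) + w ⬝ᵥ (I *ᵥ v - S) := by
  have hs : v ⬝ᵥ I *ᵥ w = w ⬝ᵥ I *ᵥ v := by
    rw [Matrix.dotProduct_mulVec, ← Matrix.mulVec_transpose, hI, dotProduct_comm]
  rw [Matrix.mulVec_add, add_dotProduct, dotProduct_add, dotProduct_add, dotProduct_add,
    dotProduct_sub, dotProduct_comm w S, hs]
  ring

/-- The deterministic core: if the log-likelihood is close to a quadratic on a large ball, the
weights of the truly fused edges are large and those of the others are small, then every minimizer
is close to the minimizer `v` of the quadratic on the fused subspace, and it is fused exactly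
where the true parameter is. -/
theorem oracle_property {n : ℕ} {x : ℕ → Obs p₀ p₁} {αinit α : Coef J₀₀ J₁₀ J₁₁ → ℝ}
    {lam γ s δ C ρ η B a G t : ℝ} {S v : Coef J₀₀ J₁₀ J₁₁ → ℝ}
    {I : Matrix (Coef J₀₀ J₁₀ J₁₁) (Coef J₀₀ J₁₀ J₁₁) ℝ}
    (hlam : 0 < lam) (hs : 0 < s) (hδ : 0 < δ) (ht : 0 ≤ t) (hB0 : 0 ≤ B)
    (hquad : ∀ u, ‖u‖ ≤ C → |negLogLik n x (α + s⁻¹ • u) - negLogLik n x α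
      - (1 / 2 * (u ⬝ᵥ I *ᵥ u) - S ⬝ᵥ u)| ≤ ρ)
    (hbdd : ∀ u, ‖u‖ ≤ C → |negLogLik n x (α + s⁻¹ • u) - negLogLik n x α| ≤ B)
    (hI : Iᵀ = I) (hη : ∀ w, ‖w‖ = δ → η ≤ 1 / 2 * (w ⬝ᵥ I *ᵥ w))
    (hvC : ‖v‖ + δ + 1 ≤ C) (hv : ∀ k, gap α k = 0 → gap v k = 0)
    (hgrad : ∀ w, -(G * ∑ k, if gap α k = 0 then |gap w k| else 0) ≤ w ⬝ᵥ (I *ᵥ v - S))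
    (hfused : ∀ k, gap α k = 0 → a * s * |gap αinit k| ^ γ ≤ lam)
    (hfree : ∀ k, gap α k ≠ 0 → 0 < |gap αinit k| ^ γ ∧ lam ≤ t * s * |gap αinit k| ^ γ)
    (hsep : ∀ k, gap α k ≠ 0 → 2 * C < s * |gap α k|)
    (hGa : G ≤ a) (hBa : 2 * B < a)
    (hη' : 2 * ρ + Fintype.card ↥(J₀₀ ∩ J₁₀) * (t * (2 * δ)) < η) :
    (∃ β, IsMinimizer lam γ n x αinit β) ∧ ∀ β, IsMinimizer lam γ n x αinit β →
      ‖s • (β - α) - v‖ < δ ∧ fusedEdges β = fusedEdges α := by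
  have ha : 0 < a := by linarith
  have hs' : 0 < s⁻¹ := inv_pos.2 hs
  let c : ↥(J₀₀ ∩ J₁₀) → ℝ := fun k => if gap α k = 0 then a * s else lam / |gap αinit k| ^ γ
  have hcT : ∀ k, gap α k = 0 → c k = a * s := fun k hk => if_pos hk
  have hcN : ∀ k, gap α k ≠ 0 → c k * |gap αinit k| ^ γ = lam := fun k hk => by
    simp only [c, if_neg hk]
    exact div_mul_cancel₀ _ (hfree k hk).1.ne'
  have hct : ∀ k, gap α k ≠ 0 → c k ≤ t * s := fun k hk => by
    simp only [c, if_neg hk]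
    exact (div_le_iff₀ (hfree k hk).1).2 (hfree k hk).2
  have hc0 : ∀ k, 0 ≤ c k := fun k => by
    by_cases hk : gap α k = 0
    · rw [hcT k hk]; positivity
    · simp only [c, if_neg hk]; positivity
  have hc : ∀ k, c k * |gap αinit k| ^ γ ≤ lam := fun k => by
    by_cases hk : gap α k = 0
    · rw [hcT k hk]; exact hfused k hk
    · exact (hcN k hk).le
  let F : (Coef J₀₀ J₁₀ J₁₁ → ℝ) → ℝ := fun β => negLogLik n x β + ∑ k, c k * |gap β k|
  have hF0 : ∀ β, 0 ≤ F β := fun β => add_nonneg (negLogLik_nonneg _ _ _)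
    (Finset.sum_nonneg fun k _ => mul_nonneg (hc0 k) (abs_nonneg _))
  have lower : ∀ β, ENNReal.ofReal (F β) ≤ criterion lam γ n x αinit β := le_criterion hlam hc0 hc
  have upper : ∀ β, (∀ k, gap α k = 0 → gap β k = 0) →
      criterion lam γ n x αinit β ≤ ENNReal.ofReal (F β) := fun β hβ =>
    criterion_le hlam.le hc0 fun k => by
      by_cases hk : gap α k = 0
      · exact Or.inl (hβ k hk)
      · exact Or.inr ⟨(hfree k hk).1, hcN k hk⟩
  have gapα : ∀ u k, gap (α + s⁻¹ • u) k = gap α k + s⁻¹ * gap u k := fun u k => by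
    rw [gap_add, gap_smul]
  have sphere : ∀ β, ‖β - (α + s⁻¹ • v)‖ = s⁻¹ * δ →
      criterion lam γ n x αinit (α + s⁻¹ • v) < criterion lam γ n x αinit β := by
    intro β hβ
    obtain ⟨w, rfl⟩ : ∃ w, β = α + s⁻¹ • (v + w) :=
      ⟨s • (β - (α + s⁻¹ • v)), by
        rw [smul_add, smul_smul, inv_mul_cancel₀ hs.ne', one_smul]; abel⟩
    have hw : ‖w‖ = δ := by
      rw [show α + s⁻¹ • (v + w) - (α + s⁻¹ • v) = s⁻¹ • w by module, norm_smul,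
        Real.norm_of_nonneg hs'.le] at hβ
      exact mul_left_cancel₀ hs'.ne' hβ
    have hlt : F (α + s⁻¹ • v) < F (α + s⁻¹ • (v + w)) := by
      have h₁ := abs_le.1 (hquad v (by linarith))
      have h₂ := abs_le.1 (hquad (v + w) ((norm_add_le v w).trans (by linarith)))
      have h₃ := quadratic_add_sub hI S v w
      have hpen : (a * ∑ k, if gap α k = 0 then |gap w k| else 0)
          - Fintype.card ↥(J₀₀ ∩ J₁₀) * (t * (2 * δ))
          ≤ ∑ k, c k * |gap (α + s⁻¹ • (v + w)) k| - ∑ k, c k * |gap (α + s⁻¹ • v) k| := by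
        have hconst : Fintype.card ↥(J₀₀ ∩ J₁₀) * (t * (2 * δ))
            = ∑ _k : ↥(J₀₀ ∩ J₁₀), t * (2 * δ) := by
          rw [Finset.sum_const, Finset.card_univ, nsmul_eq_mul]
        rw [hconst, Finset.mul_sum, ← Finset.sum_sub_distrib, ← Finset.sum_sub_distrib]
        refine Finset.sum_le_sum fun k _ => ?_
        rw [gapα, gapα, gap_add]
        by_cases hk : gap α k = 0
        · have hτ : 0 ≤ t * (2 * δ) := by positivity
          rw [if_pos hk, hcT k hk, hk, hv k hk]
          simp only [zero_add, mul_zero, abs_zero, sub_zero, abs_mul, abs_of_pos hs']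
          rw [show a * s * (s⁻¹ * |gap w k|) = a * |gap w k| * (s * s⁻¹) by ring,
            mul_inv_cancel₀ hs.ne', mul_one]
          linarith
        · rw [if_neg hk, mul_zero, zero_sub, ← mul_sub]
          have h₄ : -(s⁻¹ * |gap w k|) ≤ |gap α k + s⁻¹ * (gap v k + gap w k)|
              - |gap α k + s⁻¹ * gap v k| := by
            have := abs_sub_abs_le_abs_sub (gap α k + s⁻¹ * gap v k)
              (gap α k + s⁻¹ * (gap v k + gap w k))
            rw [show gap α k + s⁻¹ * gap v k - (gap α k + s⁻¹ * (gap v k + gap w k))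
              = -(s⁻¹ * gap w k) by ring, abs_neg, abs_mul, abs_of_pos hs'] at this
            linarith
          have h₅ : c k * (s⁻¹ * |gap w k|) ≤ t * (2 * δ) := by
            calc c k * (s⁻¹ * |gap w k|) ≤ t * s * (s⁻¹ * (2 * δ)) := by
                  gcongr
                  · exact hct k hk
                  · exact (abs_gap_le w k).trans (by rw [hw])
              _ = t * (2 * δ) * (s * s⁻¹) := by ring
              _ = t * (2 * δ) := by rw [mul_inv_cancel₀ hs.ne', mul_one]
          nlinarith [mul_le_mul_of_nonneg_left h₄ (hc0 k)]
      have hsum : 0 ≤ ∑ k, if gap α k = 0 then |gap w k| else 0 :=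
        Finset.sum_nonneg fun k _ => by split_ifs <;> positivity
      have h₆ := mul_le_mul_of_nonneg_right hGa hsum
      have h₇ := hgrad w
      have h₈ := hη w hw
      simp only [F]
      linarith [h₁.2, h₂.1]
    calc _ ≤ ENNReal.ofReal (F (α + s⁻¹ • v)) := upper _ fun k hk => by
            rw [gapα, hk, hv k hk]; simp
      _ < ENNReal.ofReal (F (α + s⁻¹ • (v + w))) :=
          (ENNReal.ofReal_lt_ofReal_iff ((hF0 _).trans_lt hlt)).2 hlt
      _ ≤ _ := lower _
  obtain ⟨hex, hball⟩ := exists_isMinimizer_of_sphere (by positivity) sphere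
  refine ⟨hex, fun β hβ => ?_⟩
  obtain ⟨u, rfl⟩ : ∃ u, β = α + s⁻¹ • u :=
    ⟨s • (β - α), by rw [smul_smul, inv_mul_cancel₀ hs.ne', one_smul]; abel⟩
  have huv : ‖u - v‖ < δ := by
    have := hball _ hβ
    rw [show α + s⁻¹ • u - (α + s⁻¹ • v) = s⁻¹ • (u - v) by module, norm_smul,
      Real.norm_of_nonneg hs'.le] at this
    exact lt_of_mul_lt_mul_left this hs'.le
  have hu : ‖u‖ < C - 1 := by
    have := norm_add_le (u - v) v
    rw [sub_add_cancel] at this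
    linarith
  refine ⟨by rwa [add_sub_cancel_left, smul_smul, mul_inv_cancel₀ hs.ne', one_smul], ?_⟩
  let u' : Coef J₀₀ J₁₀ J₁₁ → ℝ := fun c => u (collapse α c)
  have hu' : ‖u'‖ ≤ ‖u‖ := (pi_norm_le_iff_of_nonneg (norm_nonneg u)).2 fun c =>
    norm_le_pi_norm u _
  have gap_fused : ∀ k, gap α k = 0 → gap u' k = 0 := fun k hk => by
    have h₁ : collapse α (common1 k) = common0 k := by
      rw [collapse_common1, if_pos (sub_eq_zero.1 hk)]
    have h₀ : collapse α (common0 k) = common0 k := rfl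
    simp only [gap, u', h₁, h₀, sub_self]
  have gap_free : ∀ k, gap α k ≠ 0 → gap u' k = gap u k := fun k hk => by
    have h₁ : collapse α (common1 k) = common1 k := by
      rw [collapse_common1, if_neg (sub_ne_zero.1 hk)]
    have h₀ : collapse α (common0 k) = common0 k := rfl
    simp only [gap, u', h₁, h₀]
  have hFF : F (α + s⁻¹ • u) ≤ F (α + s⁻¹ • u') := by
    refine (ENNReal.ofReal_le_ofReal_iff (hF0 _)).1 ?_
    refine (lower _).trans ((hβ _).trans (upper _ fun k hk => ?_))
    rw [gapα, hk, gap_fused k hk]; simp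
  have hlip : negLogLik n x (α + s⁻¹ • u') - negLogLik n x (α + s⁻¹ • u) ≤ 2 * B * ‖u' - u‖ := by
    have hconv : ConvexOn ℝ (Metric.ball 0 C)
        fun u => negLogLik n x (α + s⁻¹ • u) - negLogLik n x α := by
      refine ⟨convex_ball 0 C, fun y _ z _ b d hb hd hbd => ?_⟩
      have := (convexOn_negLogLik n x).2 (Set.mem_univ (α + s⁻¹ • y))
        (Set.mem_univ (α + s⁻¹ • z)) hb hd hbd
      rw [show b • (α + s⁻¹ • y) + d • (α + s⁻¹ • z)
        = (b + d) • α + s⁻¹ • (b • y + d • z) by module, hbd, one_smul] at this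
      simp only [smul_eq_mul] at this ⊢
      linear_combination this + negLogLik n x α * hbd
    have hl := hconv.lipschitzOnWith_of_abs_le one_pos
      (fun y hy => hbdd y (by rw [dist_zero_right] at hy; exact hy.le))
    have := hl.dist_le_mul u' (by simpa using hu'.trans_lt hu) u (by simpa using hu)
    rw [div_one, Real.coe_toNNReal _ (by positivity), Real.dist_eq, dist_eq_norm,
      sub_sub_sub_cancel_right] at this
    exact (le_abs_self _).trans this
  have hnorm : ‖u' - u‖ ≤ ∑ k, if gap α k = 0 then |gap u k| else 0 := by
    refine (pi_norm_le_iff_of_nonneg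
      (Finset.sum_nonneg fun k _ => by split_ifs <;> positivity)).2 fun c => ?_
    rw [Pi.sub_apply, Real.norm_eq_abs, abs_sub_comm]
    refine (abs_sub_collapse_le α u c).trans (le_of_eq ?_)
    simp only [gap, sub_eq_zero]
  have hpen : a * (∑ k, if gap α k = 0 then |gap u k| else 0)
      = ∑ k, c k * |gap (α + s⁻¹ • u) k| - ∑ k, c k * |gap (α + s⁻¹ • u') k| := by
    rw [Finset.mul_sum, ← Finset.sum_sub_distrib]
    refine Finset.sum_congr rfl fun k _ => ?_
    rw [gapα, gapα]
    by_cases hk : gap α k = 0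
    · rw [if_pos hk, hcT k hk, hk, gap_fused k hk]
      simp only [zero_add, mul_zero, abs_zero, sub_zero, abs_mul, abs_of_pos hs']
      field_simp
    · rw [if_neg hk, gap_free k hk]
      ring
  have hzero : (∑ k, if gap α k = 0 then |gap u k| else 0) ≤ 0 := by
    have h₁ : a * (∑ k, if gap α k = 0 then |gap u k| else 0)
        ≤ 2 * B * ∑ k, if gap α k = 0 then |gap u k| else 0 := by
      have := mul_le_mul_of_nonneg_left hnorm (by positivity : 0 ≤ 2 * B)
      simp only [F] at hFF
      linarith
    by_contra! hpos
    exact absurd (le_of_mul_le_mul_right h₁ hpos) (not_le.2 hBa)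
  refine fusedEdges_congr fun k => ?_
  rw [← sub_eq_zero, ← sub_eq_zero (a := α (common1 k))]
  change gap (α + s⁻¹ • u) k = 0 ↔ gap α k = 0
  rw [gapα]
  by_cases hk : gap α k = 0
  · have h₁ := Finset.single_le_sum
      (f := fun k => if gap α k = 0 then |gap u k| else 0)
      (fun k _ => by split_ifs <;> positivity) (Finset.mem_univ k)
    simp only [hk, if_true] at h₁
    have : gap u k = 0 := abs_eq_zero.1 (le_antisymm (h₁.trans hzero) (abs_nonneg _))
    simp [hk, this]
  · refine iff_of_false (fun h => ?_) hk
    have h₁ : s * |gap α k| = |gap u k| := by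
      rw [eq_neg_of_add_eq_zero_left h, abs_neg, abs_mul, abs_of_pos hs', ← mul_assoc,
        mul_inv_cancel₀ hs.ne', one_mul]
    linarith [hsep k hk, abs_gap_le u k]

end Oracle

section Expansion

variable {p₀ p₁ : ℕ} {J₀₀ J₁₀ : Finset (Fin p₀)} {J₁₁ : Finset (Fin p₁)}

/-- The contribution of one record to the observed information. -/
noncomputable def infoTerm (α : Coef J₀₀ J₁₀ J₁₁ → ℝ) (c d : Coef J₀₀ J₁₀ J₁₁)
    (o : Obs p₀ p₁) : ℝ :=
  ∑ τ : Fin 2, prob τ o α * (1 - prob τ o α) * design τ o c * design τ o d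

/-- The contribution of one record to the bound on the Taylor remainder. -/
noncomputable def remainderTerm (J₀₀ J₁₀ : Finset (Fin p₀)) (J₁₁ : Finset (Fin p₁))
    (M : Fin 2 → Obs p₀ p₁ → ℝ) (o : Obs p₀ p₁) : ℝ :=
  ∑ τ : Fin 2, ∑ c : Coef J₀₀ J₁₀ J₁₁, ∑ d : Coef J₀₀ J₁₀ J₁₁, ∑ e : Coef J₀₀ J₁₀ J₁₁,
    M τ o * |design τ o c * design τ o d * design τ o e|

/-- The normalized score of the first `n` records. -/
noncomputable def normScore (n : ℕ) (x : ℕ → Obs p₀ p₁) (α : Coef J₀₀ J₁₀ J₁₁ → ℝ)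
    (c : Coef J₀₀ J₁₀ J₁₁) : ℝ :=
  (√(n : ℝ))⁻¹ * ∑ i ∈ Finset.range n, score (x i) α c

/-- The distance of the observed information of the first `n` records from a matrix. -/
noncomputable def infoError (n : ℕ) (x : ℕ → Obs p₀ p₁) (α : Coef J₀₀ J₁₀ J₁₁ → ℝ)
    (I : Matrix (Coef J₀₀ J₁₀ J₁₁) (Coef J₀₀ J₁₀ J₁₁) ℝ) : ℝ :=
  ∑ c, ∑ d, |(∑ i ∈ Finset.range n, infoTerm α c d (x i)) / n - I c d|

theorem sum_abs_pow_three {κ : Type*} [Fintype κ] (X : κ → ℝ) :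
    (∑ c, |X c|) ^ 3 = ∑ c, ∑ d, ∑ e, |X c * X d * X e| := by
  simp only [abs_mul, ← Finset.mul_sum, ← Finset.sum_mul]
  ring

theorem dotProduct_mulVec_le {κ : Type*} [Fintype κ] {u : κ → ℝ} {C : ℝ} (hu : ‖u‖ ≤ C)
    (A : Matrix κ κ ℝ) : |u ⬝ᵥ A *ᵥ u| ≤ C ^ 2 * ∑ c, ∑ d, |A c d| := by
  have hC : 0 ≤ C := (norm_nonneg u).trans hu
  have huc : ∀ c, |u c| ≤ C := fun c => (norm_le_pi_norm u c).trans hu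
  simp only [dotProduct, Matrix.mulVec, Finset.mul_sum]
  refine (Finset.abs_sum_le_sum_abs _ _).trans (Finset.sum_le_sum fun c _ => ?_)
  refine (Finset.abs_sum_le_sum_abs _ _).trans (Finset.sum_le_sum fun d _ => ?_)
  rw [abs_mul, abs_mul]
  calc |u c| * (|A c d| * |u d|) = (|u c| * |u d|) * |A c d| := by ring
    _ ≤ (C * C) * |A c d| := by gcongr <;> exact huc _
    _ = C ^ 2 * |A c d| := by ring

theorem abs_dotProduct_le_mul_sum {κ : Type*} [Fintype κ] {u : κ → ℝ} {C : ℝ} (hu : ‖u‖ ≤ C)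
    (y : κ → ℝ) : |u ⬝ᵥ y| ≤ C * ∑ c, |y c| := by
  simp only [dotProduct, Finset.mul_sum]
  refine (Finset.abs_sum_le_sum_abs _ _).trans (Finset.sum_le_sum fun c _ => ?_)
  rw [abs_mul]
  gcongr
  exact (norm_le_pi_norm u c).trans hu

theorem logit_add_smul (τ : Fin 2) (o : Obs p₀ p₁) (α u : Coef J₀₀ J₁₀ J₁₁ → ℝ) (t : ℝ) :
    ∑ c, (α + t • u) c * design τ o c
      = ∑ c, α c * design τ o c + t * (u ⬝ᵥ design τ o) := by
  simp only [dotProduct, Pi.add_apply, Pi.smul_apply, smul_eq_mul, add_mul,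
    Finset.sum_add_distrib, Finset.mul_sum, mul_assoc]

/-- The log-likelihood increment minus its second order Taylor polynomial. -/
theorem negLogLik_taylor_eq {n : ℕ} (hn : 0 < n) (x : ℕ → Obs p₀ p₁)
    (α u : Coef J₀₀ J₁₀ J₁₁ → ℝ) :
    negLogLik n x (α + (√(n : ℝ))⁻¹ • u) - negLogLik n x α
      - (1 / 2 * (u ⬝ᵥ (Matrix.of fun c d =>
          (∑ i ∈ Finset.range n, infoTerm α c d (x i)) / n) *ᵥ u) - normScore n x α ⬝ᵥ u)
    = ∑ τ : Fin 2, ∑ i ∈ Finset.range n,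
        (softplus (∑ c, α c * design τ (x i) c + (√(n : ℝ))⁻¹ * (u ⬝ᵥ design τ (x i)))
          - softplus (∑ c, α c * design τ (x i) c)
          - (√(n : ℝ))⁻¹ * (u ⬝ᵥ design τ (x i)) * prob τ (x i) α
          - ((√(n : ℝ))⁻¹ * (u ⬝ᵥ design τ (x i))) ^ 2 / 2
            * (prob τ (x i) α * (1 - prob τ (x i) α))) := by
  have hn' : (0 : ℝ) < n := Nat.cast_pos.2 hn
  have hsq : ((√(n : ℝ))⁻¹) ^ 2 = (n : ℝ)⁻¹ := by rw [inv_pow, Real.sq_sqrt hn'.le]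
  have hS : normScore n x α ⬝ᵥ u = ∑ τ : Fin 2, ∑ i ∈ Finset.range n,
      (trt τ (x i) - prob τ (x i) α) * ((√(n : ℝ))⁻¹ * (u ⬝ᵥ design τ (x i))) := by
    simp only [dotProduct, normScore, score, Finset.mul_sum, Finset.sum_mul]
    rw [Finset.sum_comm]
    simp only [Finset.sum_comm (s := (Finset.univ : Finset (Coef J₀₀ J₁₀ J₁₁)))
      (t := (Finset.univ : Finset (Fin 2)))]
    rw [Finset.sum_comm]
    refine Finset.sum_congr rfl fun τ _ => Finset.sum_congr rfl fun i _ =>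
      Finset.sum_congr rfl fun c _ => ?_
    ring
  have hI : u ⬝ᵥ (Matrix.of fun c d =>
      (∑ i ∈ Finset.range n, infoTerm α c d (x i)) / n) *ᵥ u = ∑ τ : Fin 2, ∑ i ∈ Finset.range n,
      ((√(n : ℝ))⁻¹ * (u ⬝ᵥ design τ (x i))) ^ 2 * (prob τ (x i) α * (1 - prob τ (x i) α)) := by
    have hr : ∀ τ i, ((√(n : ℝ))⁻¹ * (u ⬝ᵥ design τ (x i))) ^ 2
        * (prob τ (x i) α * (1 - prob τ (x i) α)) = ∑ c, ∑ d, (n : ℝ)⁻¹ * (u c * u d)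
          * (prob τ (x i) α * (1 - prob τ (x i) α) * design τ (x i) c * design τ (x i) d) := by
      intro τ i
      rw [mul_pow, hsq, sq, dotProduct, Finset.sum_mul_sum, Finset.mul_sum, Finset.sum_mul]
      refine Finset.sum_congr rfl fun c _ => ?_
      rw [Finset.mul_sum, Finset.sum_mul]
      refine Finset.sum_congr rfl fun d _ => ?_
      ring
    have hl : ∀ c d, u c * ((∑ i ∈ Finset.range n, infoTerm α c d (x i)) / n * u d)
        = ∑ τ : Fin 2, ∑ i ∈ Finset.range n, (n : ℝ)⁻¹ * (u c * u d)
          * (prob τ (x i) α * (1 - prob τ (x i) α) * design τ (x i) c * design τ (x i) d) := by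
      intro c d
      simp only [← Finset.mul_sum]
      rw [Finset.sum_comm]
      simp only [infoTerm]
      ring
    simp only [hr]
    simp only [dotProduct, Matrix.mulVec, Matrix.of_apply, Finset.mul_sum, hl]
    calc ∑ c, ∑ d, ∑ τ : Fin 2, ∑ i ∈ Finset.range n, (n : ℝ)⁻¹ * (u c * u d)
          * (prob τ (x i) α * (1 - prob τ (x i) α) * design τ (x i) c * design τ (x i) d)
        = ∑ c, ∑ τ : Fin 2, ∑ i ∈ Finset.range n, ∑ d, (n : ℝ)⁻¹ * (u c * u d)
          * (prob τ (x i) α * (1 - prob τ (x i) α) * design τ (x i) c * design τ (x i) d) := by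
          refine Finset.sum_congr rfl fun c _ => ?_
          rw [Finset.sum_comm]
          exact Finset.sum_congr rfl fun τ _ => Finset.sum_comm
      _ = _ := by
          rw [Finset.sum_comm]
          exact Finset.sum_congr rfl fun τ _ => Finset.sum_comm
  rw [hS, hI, negLogLik_eq, negLogLik_eq, Finset.mul_sum, ← Finset.sum_sub_distrib,
    ← Finset.sum_sub_distrib, ← Finset.sum_sub_distrib]
  refine Finset.sum_congr rfl fun τ _ => ?_
  rw [Finset.mul_sum, ← Finset.sum_sub_distrib, ← Finset.sum_sub_distrib,
    ← Finset.sum_sub_distrib]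
  refine Finset.sum_congr rfl fun i _ => ?_
  rw [logit_add_smul]
  ring

/-- Quadratic approximation of the log-likelihood on balls of radius of order `1 / √n`. -/
theorem abs_negLogLik_expansion_le {n : ℕ} (hn : 0 < n) {x : ℕ → Obs p₀ p₁}
    {α u : Coef J₀₀ J₁₀ J₁₁ → ℝ} {r C : ℝ} {M : Fin 2 → Obs p₀ p₁ → ℝ}
    (I : Matrix (Coef J₀₀ J₁₀ J₁₁) (Coef J₀₀ J₁₀ J₁₁) ℝ)
    (hM : ∀ τ i, ∀ β ∈ Metric.ball α r, |prob τ (x i) β * (1 - prob τ (x i) β)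
      * (1 - 2 * prob τ (x i) β)| ≤ M τ (x i))
    (hu : ‖u‖ ≤ C) (hC : C < r * √(n : ℝ)) :
    |negLogLik n x (α + (√(n : ℝ))⁻¹ • u) - negLogLik n x α
      - (1 / 2 * (u ⬝ᵥ I *ᵥ u) - normScore n x α ⬝ᵥ u)|
    ≤ C ^ 2 / 2 * infoError n x α I + C ^ 3 / 6 * ((√(n : ℝ))⁻¹
      * ((∑ i ∈ Finset.range n, remainderTerm J₀₀ J₁₀ J₁₁ M (x i)) / n)) := by
  have hn' : (0 : ℝ) < n := Nat.cast_pos.2 hn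
  have hs : 0 < √(n : ℝ) := Real.sqrt_pos.2 hn'
  have hC0 : 0 ≤ C := (norm_nonneg u).trans hu
  set A : Matrix (Coef J₀₀ J₁₀ J₁₁) (Coef J₀₀ J₁₀ J₁₁) ℝ :=
    Matrix.of fun c d => (∑ i ∈ Finset.range n, infoTerm α c d (x i)) / n with hA
  have hM0 : ∀ τ i, 0 ≤ M τ (x i) := fun τ i =>
    (abs_nonneg _).trans (hM τ i α (Metric.mem_ball_self
      (pos_of_mul_pos_left (hC0.trans_lt hC) hs.le)))
  have hrem : |negLogLik n x (α + (√(n : ℝ))⁻¹ • u) - negLogLik n x α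
      - (1 / 2 * (u ⬝ᵥ A *ᵥ u) - normScore n x α ⬝ᵥ u)| ≤ C ^ 3 / 6 * ((√(n : ℝ))⁻¹
      * ((∑ i ∈ Finset.range n, remainderTerm J₀₀ J₁₀ J₁₁ M (x i)) / n)) := by
    have hcube : (√(n : ℝ))⁻¹ ^ 3 = (√(n : ℝ))⁻¹ * (n : ℝ)⁻¹ := by
      rw [pow_succ', inv_pow, Real.sq_sqrt hn'.le]
    have hsplit : C ^ 3 / 6 * ((√(n : ℝ))⁻¹
        * ((∑ i ∈ Finset.range n, remainderTerm J₀₀ J₁₀ J₁₁ M (x i)) / n))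
        = ∑ τ : Fin 2, ∑ i ∈ Finset.range n, M τ (x i)
          * ((√(n : ℝ))⁻¹ * (C * ∑ c : Coef J₀₀ J₁₀ J₁₁, |design τ (x i) c|)) ^ 3 / 6 := by
      rw [Finset.sum_comm, div_eq_mul_inv _ (n : ℝ), Finset.sum_mul, Finset.mul_sum,
        Finset.mul_sum]
      refine Finset.sum_congr rfl fun i _ => ?_
      simp only [remainderTerm, ← Finset.mul_sum, ← sum_abs_pow_three]
      rw [Finset.sum_mul, Finset.mul_sum, Finset.mul_sum]
      refine Finset.sum_congr rfl fun τ _ => ?_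
      rw [mul_pow, mul_pow, hcube]
      ring
    rw [hA, negLogLik_taylor_eq hn, hsplit]
    refine (Finset.abs_sum_le_sum_abs _ _).trans (Finset.sum_le_sum fun τ _ => ?_)
    refine (Finset.abs_sum_le_sum_abs _ _).trans (Finset.sum_le_sum fun i _ => ?_)
    have hh : |(√(n : ℝ))⁻¹ * (u ⬝ᵥ design τ (x i))|
        ≤ (√(n : ℝ))⁻¹ * (C * ∑ c : Coef J₀₀ J₁₀ J₁₁, |design τ (x i) c|) := by
      rw [abs_mul, abs_of_pos (inv_pos.2 hs)]
      gcongr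
      exact abs_dotProduct_le_mul_sum hu _
    refine (abs_softplus_taylor_le (K := M τ (x i)) fun t ht => ?_).trans ?_
    · have := hM τ i (α + (t * (√(n : ℝ))⁻¹) • u) (by
        rw [Metric.mem_ball, dist_eq_norm, add_sub_cancel_left, norm_smul,
          Real.norm_of_nonneg (mul_nonneg ht.1 (inv_pos.2 hs).le)]
        calc t * (√(n : ℝ))⁻¹ * ‖u‖ ≤ 1 * (√(n : ℝ))⁻¹ * C := by
              gcongr
              exact ht.2
          _ = C / √(n : ℝ) := by rw [one_mul, inv_mul_eq_div]
          _ < r := (div_lt_iff₀ hs).2 hC)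
      simp only [prob, logit_add_smul, mul_assoc t] at this
      exact this
    · have := hM0 τ i
      gcongr
  have hdiff : |1 / 2 * (u ⬝ᵥ A *ᵥ u) - 1 / 2 * (u ⬝ᵥ I *ᵥ u)|
      ≤ C ^ 2 / 2 * infoError n x α I := by
    rw [← mul_sub, ← dotProduct_sub, ← Matrix.sub_mulVec, abs_mul]
    have := dotProduct_mulVec_le hu (A - I)
    rw [abs_of_pos (by norm_num : (0 : ℝ) < 1 / 2)]
    calc 1 / 2 * |u ⬝ᵥ (A - I) *ᵥ u| ≤ 1 / 2 * (C ^ 2 * ∑ c, ∑ d, |(A - I) c d|) := by gcongr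
      _ = _ := by simp only [infoError, hA, Matrix.sub_apply, Matrix.of_apply]; ring
  have := abs_add_le (negLogLik n x (α + (√(n : ℝ))⁻¹ • u) - negLogLik n x α
      - (1 / 2 * (u ⬝ᵥ A *ᵥ u) - normScore n x α ⬝ᵥ u))
      (1 / 2 * (u ⬝ᵥ A *ᵥ u) - 1 / 2 * (u ⬝ᵥ I *ᵥ u))
  refine le_trans (le_of_eq ?_) (this.trans ?_)
  · congr 1; ring
  · linarith

end Expansion

section Reduction

variable {p₀ p₁ : ℕ} {J₀₀ J₁₀ : Finset (Fin p₀)} {J₁₁ : Finset (Fin p₁)}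

/-- The Fisher information of the reduced parameter. -/
noncomputable def reducedInfo (α : Coef J₀₀ J₁₀ J₁₁ → ℝ)
    (I : Matrix (Coef J₀₀ J₁₀ J₁₁) (Coef J₀₀ J₁₀ J₁₁) ℝ) : Matrix (Reduced α) (Reduced α) ℝ :=
  (expandMatrix α)ᵀ * I * expandMatrix α

/-- The matrix that takes the score to the minimizer of the reduced quadratic. -/
noncomputable def influence (α : Coef J₀₀ J₁₀ J₁₁ → ℝ)
    (I : Matrix (Coef J₀₀ J₁₀ J₁₁) (Coef J₀₀ J₁₀ J₁₁) ℝ) :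
    Matrix (Reduced α) (Coef J₀₀ J₁₀ J₁₁) ℝ :=
  (reducedInfo α I)⁻¹ * (expandMatrix α)ᵀ

variable {α : Coef J₀₀ J₁₀ J₁₁ → ℝ} {I : Matrix (Coef J₀₀ J₁₀ J₁₁) (Coef J₀₀ J₁₀ J₁₁) ℝ}

theorem posDef_reducedInfo (hI : I.PosDef) : (reducedInfo α I).PosDef := by
  have := hI.conjTranspose_mul_mul_same (B := expandMatrix α) (expandMatrix_mulVec_injective α)
  rwa [Matrix.conjTranspose_eq_transpose_of_trivial] at this

/-- The gradient of the quadratic at the reduced minimizer is orthogonal to fused vectors. -/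
theorem expandMatrix_mulVec_dotProduct_gradient (hI : I.PosDef) (S : Coef J₀₀ J₁₀ J₁₁ → ℝ)
    (y : Reduced α → ℝ) :
    (expandMatrix α *ᵥ y) ⬝ᵥ (I *ᵥ (expandMatrix α *ᵥ (influence α I *ᵥ S)) - S) = 0 := by
  have hdet : IsUnit (reducedInfo α I).det := (Matrix.isUnit_iff_isUnit_det _).1
    (posDef_reducedInfo hI).isUnit
  have h : (expandMatrix α)ᵀ *ᵥ (I *ᵥ (expandMatrix α *ᵥ (influence α I *ᵥ S)) - S) = 0 := by
    rw [Matrix.mulVec_sub, Matrix.mulVec_mulVec, Matrix.mulVec_mulVec, Matrix.mulVec_mulVec,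
      influence, ← Matrix.mul_assoc]
    change (reducedInfo α I * (reducedInfo α I)⁻¹ * (expandMatrix α)ᵀ) *ᵥ S - _ = 0
    rw [Matrix.mul_nonsing_inv _ hdet, Matrix.one_mul, sub_self]
  rw [dotProduct_comm, Matrix.dotProduct_mulVec, ← Matrix.mulVec_transpose, h, zero_dotProduct]

theorem neg_le_dotProduct_gradient (hI : I.PosDef) (S w : Coef J₀₀ J₁₀ J₁₁ → ℝ) {g : ℝ}
    (hg : ∑ c, |(I *ᵥ (expandMatrix α *ᵥ (influence α I *ᵥ S)) - S) c| ≤ g) :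
    -(g * ∑ k, if gap α k = 0 then |gap w k| else 0)
      ≤ w ⬝ᵥ (I *ᵥ (expandMatrix α *ᵥ (influence α I *ᵥ S)) - S) := by
  set q := I *ᵥ (expandMatrix α *ᵥ (influence α I *ᵥ S)) - S with hq
  have h₀ : (fun c => w (collapse α c)) ⬝ᵥ q = 0 := by
    rw [← expandMatrix_mulVec_comp_val, hq, expandMatrix_mulVec_dotProduct_gradient hI]
  set D := ∑ k, if gap α k = 0 then |gap w k| else 0 with hD
  have hD0 : 0 ≤ D := Finset.sum_nonneg fun k _ => by split_ifs <;> positivity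
  have h₁ : ‖w - fun c => w (collapse α c)‖ ≤ D := by
    refine (pi_norm_le_iff_of_nonneg hD0).2 fun c => ?_
    refine (abs_sub_collapse_le α w c).trans (le_of_eq ?_)
    simp only [hD, gap, sub_eq_zero]
  have h₂ := abs_dotProduct_le_mul_sum h₁ q
  rw [sub_dotProduct, h₀, sub_zero] at h₂
  have h₃ := mul_le_mul_of_nonneg_left hg hD0
  linarith [(abs_le.1 h₂).1]

theorem transpose_eq_of_posDef {κ : Type*} {A : Matrix κ κ ℝ} (hA : A.PosDef) : Aᵀ = A := by
  rw [← Matrix.conjTranspose_eq_transpose_of_trivial]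
  exact hA.isHermitian

theorem asymptoticCov_eq (P : Measure (Obs p₀ p₁)) (hI : (fisherInfo P α).PosDef) :
    asymptoticCov P α
      = influence α (fisherInfo P α) * scoreCov P α * (influence α (fisherInfo P α))ᵀ := by
  have hH : ((reducedInfo α (fisherInfo P α))⁻¹)ᵀ = (reducedInfo α (fisherInfo P α))⁻¹ := by
    rw [Matrix.transpose_nonsing_inv, transpose_eq_of_posDef (posDef_reducedInfo hI)]
  rw [influence, Matrix.transpose_mul, hH, Matrix.transpose_transpose]
  simp only [asymptoticCov, reducedInfo, Matrix.mul_assoc]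

theorem exists_pos_le_quadratic_of_norm_eq {κ : Type*} [Fintype κ] {A : Matrix κ κ ℝ}
    (hA : A.PosDef) {δ : ℝ} (hδ : 0 < δ) :
    ∃ η, 0 < η ∧ ∀ w : κ → ℝ, ‖w‖ = δ → η ≤ 1 / 2 * (w ⬝ᵥ A *ᵥ w) := by
  rcases (Metric.sphere (0 : κ → ℝ) δ).eq_empty_or_nonempty with h | h
  · exact ⟨1, one_pos, fun w hw => absurd (mem_sphere_zero_iff_norm.2 hw) (h ▸ Set.notMem_empty w)⟩
  · have hcont : Continuous fun w : κ → ℝ => 1 / 2 * (w ⬝ᵥ A *ᵥ w) := by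
      simp only [dotProduct, Matrix.mulVec]
      fun_prop
    obtain ⟨w₀, hw₀, hmin⟩ := (isCompact_sphere (0 : κ → ℝ) δ).exists_isMinOn h hcont.continuousOn
    refine ⟨_, ?_, fun w hw => hmin (mem_sphere_zero_iff_norm.2 hw)⟩
    have hne : w₀ ≠ 0 := by
      rintro rfl
      rw [mem_sphere_zero_iff_norm, norm_zero] at hw₀
      exact hδ.ne hw₀
    have := hA.dotProduct_mulVec_pos hne
    rw [star_trivial] at this
    positivity

end Reduction

section BoundedInProbability

variable {Ω : Type*} [MeasurableSpace Ω] {μ : Measure Ω}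

/-- `Z_n` is bounded above in probability. -/
def BoundedAboveInProb (μ : Measure Ω) (Z : ℕ → Ω → ℝ) : Prop :=
  ∀ ε : ℝ≥0∞, 0 < ε → ∃ C : ℝ, ∀ᶠ n : ℕ in atTop, μ {ω | C < Z n ω} ≤ ε

theorem BoundedAboveInProb.add {Z W : ℕ → Ω → ℝ} (hZ : BoundedAboveInProb μ Z)
    (hW : BoundedAboveInProb μ W) : BoundedAboveInProb μ fun n ω => Z n ω + W n ω := by
  intro ε hε
  obtain ⟨C, hC⟩ := hZ (ε / 2) (ENNReal.half_pos hε.ne')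
  obtain ⟨D, hD⟩ := hW (ε / 2) (ENNReal.half_pos hε.ne')
  refine ⟨C + D, ?_⟩
  filter_upwards [hC, hD] with n hCn hDn
  calc μ {ω | C + D < Z n ω + W n ω} ≤ μ ({ω | C < Z n ω} ∪ {ω | D < W n ω}) := by
        refine measure_mono fun ω hω => ?_
        by_contra! hcon
        simp only [Set.mem_union, Set.mem_ofPred_eq, not_or, not_lt] at hcon hω
        linarith
    _ ≤ ε / 2 + ε / 2 := (measure_union_le _ _).trans (add_le_add hCn hDn)
    _ = ε := ENNReal.add_halves ε

theorem BoundedAboveInProb.sum {ι : Type*} (s : Finset ι) {Z : ι → ℕ → Ω → ℝ}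
    (hZ : ∀ i ∈ s, BoundedAboveInProb μ (Z i)) :
    BoundedAboveInProb μ fun n ω => ∑ i ∈ s, Z i n ω := by
  classical
  induction s using Finset.induction_on with
  | empty => exact fun ε _ => ⟨0, Eventually.of_forall fun n => by simp⟩
  | insert i s hi ih =>
    simp only [Finset.sum_insert hi]
    exact (hZ i (Finset.mem_insert_self i s)).add
      (ih fun j hj => hZ j (Finset.mem_insert_of_mem hj))

end BoundedInProbability

section Asymptotics

variable {p₀ p₁ : ℕ} {J₀₀ J₁₀ : Finset (Fin p₀)} {J₁₁ : Finset (Fin p₁)}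
  {P : Measure (Obs p₀ p₁)} {α : Coef J₀₀ J₁₀ J₁₁ → ℝ}
  {Ω : Type*} [MeasurableSpace Ω] {μ : Measure Ω}
  {O : ℕ → Ω → Obs p₀ p₁}

theorem integrable_infoTerm (hfisher : FisherRegular P α) (c d : Coef J₀₀ J₁₀ J₁₁) :
    Integrable (infoTerm α c d) P :=
  integrable_finsetSum _ fun τ _ => hfisher.1 τ c d

theorem integral_infoTerm (hfisher : FisherRegular P α) (c d : Coef J₀₀ J₁₀ J₁₁) :
    ∫ o, infoTerm α c d o ∂P = fisherInfo P α c d :=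
  integral_finsetSum _ fun τ _ => hfisher.1 τ c d

theorem integrable_remainderTerm {M : Fin 2 → Obs p₀ p₁ → ℝ}
    (hM : ∀ (τ : Fin 2) (c d e : Coef J₀₀ J₁₀ J₁₁), Integrable
      (fun o => M τ o * |design τ o c * design τ o d * design τ o e|) P) :
    Integrable (remainderTerm J₀₀ J₁₀ J₁₁ M) P :=
  integrable_finsetSum _ fun τ _ => integrable_finsetSum _ fun c _ =>
    integrable_finsetSum _ fun d _ => integrable_finsetSum _ fun e _ => hM τ c d e

theorem tendsto_infoError [IsProbabilityMeasure μ]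
    (hOmeas : ∀ i, Measurable (O i)) (hOindep : iIndepFun O μ)
    (hOlaw : ∀ i, μ.map (O i) = P) (hfisher : FisherRegular P α) :
    ∀ᵐ ω ∂μ, Tendsto (fun n => infoError n (fun i => O i ω) α (fisherInfo P α)) atTop (𝓝 0) := by
  have h : ∀ c d, ∀ᵐ ω ∂μ, Tendsto (fun n : ℕ => (∑ i ∈ Finset.range n,
      infoTerm α c d (O i ω)) / n) atTop (𝓝 (fisherInfo P α c d)) := fun c d => by
    rw [← integral_infoTerm hfisher]
    exact tendsto_average hOmeas hOindep hOlaw (integrable_infoTerm hfisher c d)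
  filter_upwards [ae_all_iff.2 fun c => ae_all_iff.2 fun d => h c d] with ω hω
  have h0 : (0 : ℝ) = ∑ c : Coef J₀₀ J₁₀ J₁₁, ∑ d : Coef J₀₀ J₁₀ J₁₁,
      |fisherInfo P α c d - fisherInfo P α c d| := by simp
  rw [h0]
  exact tendsto_finsetSum _ fun c _ => tendsto_finsetSum _ fun d _ =>
    ((hω c d).sub_const _).abs

theorem aestronglyMeasurable_average (hOmeas : ∀ i, Measurable (O i))
    (hOlaw : ∀ i, μ.map (O i) = P) {g : Obs p₀ p₁ → ℝ} (hg : Integrable g P) (n : ℕ) :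
    AEStronglyMeasurable (fun ω => (∑ i ∈ Finset.range n, g (O i ω)) / n) μ := by
  have h : ∀ i, AEStronglyMeasurable (fun ω => g (O i ω)) μ := fun i => by
    have := hg.aestronglyMeasurable
    rw [← hOlaw i] at this
    exact this.comp_measurable (hOmeas i)
  simp only [div_eq_mul_inv]
  exact (Finset.aestronglyMeasurable_fun_sum _ fun i _ => h i).mul_const _

/-- The error of the quadratic approximation tends to zero in probability. -/
theorem tendsto_measure_expansion_error [IsProbabilityMeasure μ]
    (hOmeas : ∀ i, Measurable (O i))
    (hOindep : iIndepFun O μ) (hOlaw : ∀ i, μ.map (O i) = P) (hfisher : FisherRegular P α)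
    {M : Fin 2 → Obs p₀ p₁ → ℝ} (hM : ∀ (τ : Fin 2) (c d e : Coef J₀₀ J₁₀ J₁₁), Integrable
      (fun o => M τ o * |design τ o c * design τ o d * design τ o e|) P) (C : ℝ) {ρ : ℝ}
    (hρ : 0 < ρ) :
    Tendsto (fun n : ℕ => μ {ω | ρ < C ^ 2 / 2 * infoError n (fun i => O i ω) α (fisherInfo P α)
      + C ^ 3 / 6 * ((√(n : ℝ))⁻¹ * ((∑ i ∈ Finset.range n,
        remainderTerm J₀₀ J₁₀ J₁₁ M (O i ω)) / n))}) atTop (𝓝 0) := by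
  have hG := integrable_remainderTerm hM
  have hlim : ∀ᵐ ω ∂μ, Tendsto (fun n : ℕ =>
      C ^ 2 / 2 * infoError n (fun i => O i ω) α (fisherInfo P α)
      + C ^ 3 / 6 * ((√(n : ℝ))⁻¹ * ((∑ i ∈ Finset.range n,
        remainderTerm J₀₀ J₁₀ J₁₁ M (O i ω)) / n))) atTop (𝓝 ((fun _ => 0) ω)) := by
    filter_upwards [tendsto_infoError hOmeas hOindep hOlaw hfisher,
      tendsto_average hOmeas hOindep hOlaw hG] with ω h₁ h₂
    have h₃ : Tendsto (fun n : ℕ => (√(n : ℝ))⁻¹) atTop (𝓝 0) :=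
      tendsto_inv_atTop_zero.comp (Real.tendsto_sqrt_atTop.comp tendsto_natCast_atTop_atTop)
    have := (h₁.const_mul (C ^ 2 / 2)).add ((h₃.mul h₂).const_mul (C ^ 3 / 6))
    simpa using this
  have hmeas : ∀ n : ℕ, AEStronglyMeasurable (fun ω =>
      C ^ 2 / 2 * infoError n (fun i => O i ω) α (fisherInfo P α)
      + C ^ 3 / 6 * ((√(n : ℝ))⁻¹ * ((∑ i ∈ Finset.range n,
        remainderTerm J₀₀ J₁₀ J₁₁ M (O i ω)) / n))) μ := fun n => by
    refine AEStronglyMeasurable.add (AEStronglyMeasurable.const_mul ?_ _)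
      (((aestronglyMeasurable_average hOmeas hOlaw hG n).const_mul _).const_mul _)
    exact Finset.aestronglyMeasurable_fun_sum _ fun c _ =>
      Finset.aestronglyMeasurable_fun_sum _ fun d _ =>
        ((aestronglyMeasurable_average hOmeas hOlaw (integrable_infoTerm hfisher c d) n).sub
          aestronglyMeasurable_const).norm
  have h := tendstoInMeasure_iff_norm.1 (tendstoInMeasure_of_tendsto_ae hmeas hlim) ρ hρ
  refine tendsto_of_tendsto_of_tendsto_of_le_of_le tendsto_const_nhds h (fun _ => zero_le)
    fun n => measure_mono fun ω hω => ?_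
  simp only [Set.mem_ofPred_eq, sub_zero] at hω ⊢
  exact hω.le.trans (le_abs_self _)

theorem boundedAboveInProb_normScore [IsProbabilityMeasure μ] [IsProbabilityMeasure P]
    (hmodel : CorrectModel P α)
    (hfisher : FisherRegular P α) (hOmeas : ∀ i, Measurable (O i)) (hOindep : iIndepFun O μ)
    (hOlaw : ∀ i, μ.map (O i) = P) (c : Coef J₀₀ J₁₀ J₁₁) :
    BoundedAboveInProb μ fun n ω => |normScore n (fun i => O i ω) α c| := by
  intro ε hε
  have hlim : Tendsto (fun K : ℝ => ENNReal.ofReal (Var[fun o => score o α c; P] / K ^ 2)) atTop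
      (𝓝 0) := by
    rw [← ENNReal.ofReal_zero]
    exact ENNReal.tendsto_ofReal (tendsto_const_nhds.div_atTop (tendsto_pow_atTop two_ne_zero))
  obtain ⟨K, hK, hK0⟩ := ((hlim.eventually_le_const hε).and (eventually_gt_atTop 0)).exists
  refine ⟨K, ?_⟩
  filter_upwards [eventually_gt_atTop 0] with n hn
  refine (measure_mono fun ω hω => ?_).trans ((measure_normalized_sum_ge_le hOmeas hOindep hOlaw
    (measurable_score α c) (memLp_score hmodel hfisher c) (integral_score hmodel hfisher c)
    hK0 hn).trans hK)
  simp only [Set.mem_ofPred_eq] at hω ⊢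
  exact hω.le

end Asymptotics

section Main

theorem sum_abs_mulVec_le {κ ι : Type*} [Fintype κ] [Fintype ι] (A : Matrix ι κ ℝ) (y : κ → ℝ) :
    ∑ c, |(A *ᵥ y) c| ≤ (∑ c, ∑ d, |A c d|) * ∑ d, |y d| := by
  rw [Finset.sum_mul]
  refine Finset.sum_le_sum fun c _ => ?_
  rw [Matrix.mulVec, dotProduct, Finset.sum_mul]
  refine (Finset.abs_sum_le_sum_abs _ _).trans (Finset.sum_le_sum fun d _ => ?_)
  rw [abs_mul]
  gcongr
  exact Finset.single_le_sum (f := fun d => |y d|) (fun _ _ => abs_nonneg _) (Finset.mem_univ d)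

theorem norm_le_sum_abs {κ : Type*} [Fintype κ] (y : κ → ℝ) : ‖y‖ ≤ ∑ c, |y c| :=
  (pi_norm_le_iff_of_nonneg (Finset.sum_nonneg fun _ _ => abs_nonneg _)).2 fun c =>
    Finset.single_le_sum (f := fun d => |y d|) (fun _ _ => abs_nonneg _) (Finset.mem_univ c)

/-- A rate condition in the form used for the weights of the fused edges. -/
theorem eventually_mul_sqrt_mul_rpow_le {lam : ℕ → ℝ} {γ : ℝ}
    (hlam₁ : Tendsto (fun n : ℕ => lam n * (n : ℝ) ^ ((γ - 1) / 2)) atTop atTop) (a : ℝ) {K : ℝ}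
    (hK : 0 ≤ K) : ∀ᶠ n : ℕ in atTop, a * √(n : ℝ) * (K / √(n : ℝ)) ^ γ ≤ lam n := by
  filter_upwards [hlam₁.eventually_ge_atTop (a * K ^ γ), eventually_gt_atTop 0] with n hn hn0
  have hn' : (0 : ℝ) < n := Nat.cast_pos.2 hn0
  have hp : 0 < (n : ℝ) ^ ((γ - 1) / 2) := Real.rpow_pos_of_pos hn' _
  have key : √(n : ℝ) * (K / √(n : ℝ)) ^ γ * (n : ℝ) ^ ((γ - 1) / 2) = K ^ γ := by
    rw [Real.div_rpow hK (Real.sqrt_nonneg _), Real.sqrt_eq_rpow, ← Real.rpow_mul hn'.le,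
      show (γ - 1) / 2 = 1 / 2 * γ - 1 / 2 by ring, Real.rpow_sub hn']
    have h₁ := Real.rpow_pos_of_pos hn' (1 / 2)
    have h₂ := Real.rpow_pos_of_pos hn' (1 / 2 * γ)
    field_simp
  refine le_of_mul_le_mul_right ?_ hp
  calc a * √(n : ℝ) * (K / √(n : ℝ)) ^ γ * (n : ℝ) ^ ((γ - 1) / 2)
      = a * (√(n : ℝ) * (K / √(n : ℝ)) ^ γ * (n : ℝ) ^ ((γ - 1) / 2)) := by ring
    _ = a * K ^ γ := by rw [key]
    _ ≤ _ := hn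

variable {p₀ p₁ : ℕ} {J₀₀ J₁₀ : Finset (Fin p₀)} {J₁₁ : Finset (Fin p₁)}
  {P : Measure (Obs p₀ p₁)} {α : Coef J₀₀ J₁₀ J₁₁ → ℝ}
  {Ω : Type*} [MeasurableSpace Ω] {μ : Measure Ω} {O : ℕ → Ω → Obs p₀ p₁}

/-- The full vector of the leading term in the expansion of the estimator. -/
noncomputable def leadingTerm (P : Measure (Obs p₀ p₁)) (α : Coef J₀₀ J₁₀ J₁₁ → ℝ) (n : ℕ)
    (x : ℕ → Obs p₀ p₁) : Coef J₀₀ J₁₀ J₁₁ → ℝ :=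
  expandMatrix α *ᵥ (influence α (fisherInfo P α) *ᵥ normScore n x α)

theorem gap_leadingTerm (n : ℕ) (x : ℕ → Obs p₀ p₁) {k : ↥(J₀₀ ∩ J₁₀)} (hk : gap α k = 0) :
    gap (leadingTerm P α n x) k = 0 := by
  have h₁ : collapse α (common1 k) = common0 k := by
    rw [collapse_common1, if_pos (sub_eq_zero.1 hk)]
  have h₀ : collapse α (common0 k) = common0 k := rfl
  simp only [gap, leadingTerm, expandMatrix_mulVec, h₁, h₀, sub_self]

/-- With probability tending to one, the normalized estimator is close to the leading term, and
its fused edges are the true ones. -/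
theorem eventually_measure_bad_le [IsProbabilityMeasure P] [IsProbabilityMeasure μ]
    (hmodel : CorrectModel P α) (hfisher : FisherRegular P α)
    (hthird : ThirdDerivDominated P α) (hOmeas : ∀ i, Measurable (O i))
    (hOindep : iIndepFun O μ) (hOlaw : ∀ i, μ.map (O i) = P)
    {γ : ℝ} (hγ : 0 < γ) {lam : ℕ → ℝ}
    (hlam₀ : Tendsto (fun n : ℕ => lam n / √(n : ℝ)) atTop (𝓝 0))
    (hlam₁ : Tendsto (fun n : ℕ => lam n * (n : ℝ) ^ ((γ - 1) / 2)) atTop atTop)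
    {αinit αhat : ℕ → Ω → Coef J₀₀ J₁₀ J₁₁ → ℝ}
    (hinit₀ : ∀ k : ↥(J₀₀ ∩ J₁₀), IsSqrtConsistent μ
      (fun n ω => αinit n ω (common0 k)) (α (common0 k)))
    (hinit₁ : ∀ k : ↥(J₀₀ ∩ J₁₀), IsSqrtConsistent μ
      (fun n ω => αinit n ω (common1 k)) (α (common1 k)))
    (hmin : ∀ n, ∀ᵐ ω ∂μ,
      (∃ β, IsMinimizer (lam n) γ n (fun i => O i ω) (αinit n ω) β) →
        IsMinimizer (lam n) γ n (fun i => O i ω) (αinit n ω) (αhat n ω))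
    {δ : ℝ} (hδ : 0 < δ) {ε : ℝ≥0∞} (hε : 0 < ε) :
    ∀ᶠ n : ℕ in atTop, μ {ω | ¬ (‖√(n : ℝ) • (αhat n ω - α) - leadingTerm P α n (fun i => O i ω)‖
      < δ ∧ fusedEdges (αhat n ω) = fusedEdges α)} ≤ ε := by
  classical
  set I := fisherInfo P α with hIdef
  have hIpd : I.PosDef := hfisher.2
  obtain ⟨U, M, hUo, hαU, hMb, hMi⟩ := hthird
  obtain ⟨r, hr, hrU⟩ := Metric.isOpen_iff.1 hUo α hαU
  obtain ⟨K₀, hK₀⟩ := ((BoundedAboveInProb.sum Finset.univ fun c _ =>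
    boundedAboveInProb_normScore hmodel hfisher hOmeas hOindep hOlaw c).add
    (BoundedAboveInProb.sum Finset.univ fun k _ =>
      BoundedAboveInProb.add (hinit₀ k) (hinit₁ k))) (ε / 2) (ENNReal.half_pos hε.ne')
  obtain ⟨K, hKdef⟩ : ∃ y : ℝ, y = max K₀ 1 := ⟨_, rfl⟩
  have hK : 0 < K := hKdef ▸ lt_max_of_lt_right one_pos
  obtain ⟨W, hW⟩ : ∃ W, W = expandMatrix α * influence α I := ⟨_, rfl⟩
  obtain ⟨V, hV⟩ : ∃ y : ℝ, y = (∑ c, ∑ d, |W c d|) * K := ⟨_, rfl⟩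
  obtain ⟨G, hG⟩ : ∃ y : ℝ, y = (∑ c, ∑ d, |(I * W - 1) c d|) * K := ⟨_, rfl⟩
  have nn : ∀ A : Matrix (Coef J₀₀ J₁₀ J₁₁) (Coef J₀₀ J₁₀ J₁₁) ℝ, 0 ≤ ∑ c, ∑ d, |A c d| :=
    fun A => Finset.sum_nonneg fun _ _ => Finset.sum_nonneg fun _ _ => abs_nonneg _
  have hV0 : 0 ≤ V := hV ▸ mul_nonneg (nn W) hK.le
  have hG0 : 0 ≤ G := hG ▸ mul_nonneg (nn _) hK.le
  obtain ⟨C, hC⟩ : ∃ y : ℝ, y = V + δ + 1 := ⟨_, rfl⟩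
  have hC0 : 0 < C := by rw [hC]; positivity
  obtain ⟨η, hη0, hη⟩ := exists_pos_le_quadratic_of_norm_eq hIpd hδ
  obtain ⟨ρ, hρ⟩ : ∃ y : ℝ, y = η / 4 := ⟨_, rfl⟩
  have hρ0 : 0 < ρ := by rw [hρ]; positivity
  obtain ⟨N, hN⟩ : ∃ y : ℝ, y = ((Fintype.card ↥(J₀₀ ∩ J₁₀) : ℕ) : ℝ) := ⟨_, rfl⟩
  have hN0 : 0 ≤ N := hN ▸ Nat.cast_nonneg _
  obtain ⟨t, ht⟩ : ∃ y : ℝ, y = η / (8 * δ * (N + 1)) := ⟨_, rfl⟩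
  have ht0 : 0 < t := by rw [ht]; positivity
  have hηt : 2 * ρ + N * (t * (2 * δ)) < η := by
    have : N * (t * (2 * δ)) = η / 4 * (N / (N + 1)) := by
      rw [ht]; field_simp; ring
    have h₂ : N / (N + 1) ≤ 1 := (div_le_one (by positivity)).2 (by linarith)
    rw [this, hρ]
    nlinarith
  obtain ⟨B, hB⟩ : ∃ y : ℝ, y = C ^ 2 / 2 * (∑ c, ∑ d, |I c d|) + C * K + ρ := ⟨_, rfl⟩
  have hB0 : 0 ≤ B := by have := nn I; rw [hB]; positivity
  obtain ⟨a, ha⟩ : ∃ y : ℝ, y = G + 2 * B + 1 := ⟨_, rfl⟩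
  have hsqrt : Tendsto (fun n : ℕ => √(n : ℝ)) atTop atTop :=
    Real.tendsto_sqrt_atTop.comp tendsto_natCast_atTop_atTop
  have hgappos : ∀ k, gap α k ≠ 0 → 0 < |gap α k| := fun k hk => abs_pos.2 hk
  have e_near : ∀ᶠ n : ℕ in atTop, C < r * √(n : ℝ) :=
    (hsqrt.const_mul_atTop hr).eventually_gt_atTop C
  have e_lam : ∀ᶠ n : ℕ in atTop, 0 < lam n := by
    filter_upwards [hlam₁.eventually_gt_atTop 0, eventually_gt_atTop 0] with n hn hn0
    exact pos_of_mul_pos_left hn (Real.rpow_nonneg (Nat.cast_nonneg n) _)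
  have e_fused := eventually_mul_sqrt_mul_rpow_le hlam₁ a hK.le
  have e_free : ∀ᶠ n : ℕ in atTop, ∀ k, gap α k ≠ 0 → K < |gap α k| / 2 * √(n : ℝ) ∧
      lam n ≤ t * √(n : ℝ) * (|gap α k| / 2) ^ γ ∧ 2 * C < √(n : ℝ) * |gap α k| := by
    rw [eventually_all]
    intro k
    by_cases hk : gap α k = 0
    · exact Eventually.of_forall fun n h => absurd hk h
    have hd := hgappos k hk
    have hd' : 0 < t * (|gap α k| / 2) ^ γ := by positivity
    filter_upwards [(hsqrt.const_mul_atTop (half_pos hd)).eventually_gt_atTop K,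
      hlam₀.eventually_le_const hd', (hsqrt.atTop_mul_const hd).eventually_gt_atTop (2 * C),
      eventually_gt_atTop 0] with n h₁ h₂ h₃ h₄ _
    refine ⟨h₁, ?_, h₃⟩
    have hs : 0 < √(n : ℝ) := Real.sqrt_pos.2 (Nat.cast_pos.2 h₄)
    rw [div_le_iff₀ hs] at h₂
    linarith
  have e_err := (tendsto_measure_expansion_error hOmeas hOindep hOlaw hfisher hMi C
    hρ0).eventually_le_const (ENNReal.half_pos hε.ne')
  have hae : ∀ᵐ ω ∂μ, ∀ τ i, ∀ β ∈ U, |prob τ (O i ω) β * (1 - prob τ (O i ω) β)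
      * (1 - 2 * prob τ (O i ω) β)| ≤ M τ (O i ω) := by
    refine ae_all_iff.2 fun τ => ae_all_iff.2 fun i => ?_
    have := hMb τ
    rw [← hOlaw i] at this
    exact ae_of_ae_map (hOmeas i).aemeasurable this
  filter_upwards [hK₀, e_near, e_lam, e_fused, e_free, e_err, eventually_gt_atTop 0]
    with n hnK hnear hlam hfus hfree herr hn
  have hn' : (0 : ℝ) < n := Nat.cast_pos.2 hn
  have hs : 0 < √(n : ℝ) := Real.sqrt_pos.2 hn'
  refine le_trans (measure_mono_ae ?_) ((measure_union_le _ _).trans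
    ((add_le_add hnK herr).trans (ENNReal.add_halves ε).le))
  filter_upwards [hae, hmin n] with ω hMω hminω hbad
  change ¬ _ at hbad
  by_contra hcon
  refine hbad ?_
  have hcon' := not_or.1 hcon
  have hZ : ∑ c, |normScore n (fun i => O i ω) α c|
      + ∑ k : ↥(J₀₀ ∩ J₁₀), (√(n : ℝ) * |αinit n ω (common0 k) - α (common0 k)|
        + √(n : ℝ) * |αinit n ω (common1 k) - α (common1 k)|) ≤ K :=
    (not_lt.1 hcon'.1).trans (hKdef ▸ le_max_left _ _)
  have hR : C ^ 2 / 2 * infoError n (fun i => O i ω) α I + C ^ 3 / 6 * ((√(n : ℝ))⁻¹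
      * ((∑ i ∈ Finset.range n, remainderTerm J₀₀ J₁₀ J₁₁ M (O i ω)) / n)) ≤ ρ :=
    not_lt.1 hcon'.2
  have hnonneg : ∀ k : ↥(J₀₀ ∩ J₁₀), 0 ≤ √(n : ℝ) * |αinit n ω (common0 k) - α (common0 k)|
        + √(n : ℝ) * |αinit n ω (common1 k) - α (common1 k)| := fun k => by positivity
  set S := normScore n (fun i => O i ω) α with hS
  have hSK : ∑ c, |S c| ≤ K := by
    linarith [Finset.sum_nonneg fun k (_ : k ∈ Finset.univ) => hnonneg k]
  have hgapinit : ∀ k, |gap (αinit n ω) k - gap α k| ≤ K / √(n : ℝ) := fun k => by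
    rw [le_div_iff₀ hs]
    have h₁ := Finset.single_le_sum (fun k _ => hnonneg k) (Finset.mem_univ k)
    have h₂ : 0 ≤ ∑ c, |S c| := Finset.sum_nonneg fun _ _ => abs_nonneg _
    have h₃ : |gap (αinit n ω) k - gap α k| ≤ |αinit n ω (common1 k) - α (common1 k)|
        + |αinit n ω (common0 k) - α (common0 k)| := by
      rw [show gap (αinit n ω) k - gap α k = (αinit n ω (common1 k) - α (common1 k))
        - (αinit n ω (common0 k) - α (common0 k)) by simp only [gap]; ring]
      exact abs_sub _ _
    nlinarith [mul_le_mul_of_nonneg_right h₃ hs.le]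
  have hlead : leadingTerm P α n (fun i => O i ω) = W *ᵥ S := by
    rw [leadingTerm, Matrix.mulVec_mulVec, hW]
  have hvV : ‖W *ᵥ S‖ ≤ V := hV ▸ (norm_le_sum_abs _).trans ((sum_abs_mulVec_le W S).trans
    (mul_le_mul_of_nonneg_left hSK (nn W)))
  have hquad : ∀ u, ‖u‖ ≤ C → |negLogLik n (fun i => O i ω) (α + (√(n : ℝ))⁻¹ • u)
      - negLogLik n (fun i => O i ω) α - (1 / 2 * (u ⬝ᵥ I *ᵥ u) - S ⬝ᵥ u)| ≤ ρ := fun u hu =>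
    (abs_negLogLik_expansion_le hn I (fun τ i β hβ => hMω τ i β (hrU hβ)) hu hnear).trans hR
  have horacle := oracle_property (n := n) (x := fun i => O i ω) (αinit := αinit n ω) (α := α)
    (lam := lam n) (γ := γ) (s := √(n : ℝ)) (δ := δ) (C := C) (ρ := ρ) (η := η) (B := B) (a := a)
    (G := G) (t := t) (S := S) (v := W *ᵥ S) (I := I) hlam hs hδ ht0.le hB0 hquad
    (fun u hu => by
      have h₁ := hquad u hu
      have h₂ := dotProduct_mulVec_le hu I
      have h₃ := abs_dotProduct_le_mul_sum hu S
      rw [dotProduct_comm] at h₃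
      have h₄ := mul_le_mul_of_nonneg_left hSK hC0.le
      rw [abs_le] at h₁ h₂ h₃ ⊢
      constructor <;> linarith [h₁.1, h₁.2, h₂.1, h₂.2, h₃.1, h₃.2])
    (transpose_eq_of_posDef hIpd) hη (by linarith)
    (fun k hk => by rw [← hlead]; exact gap_leadingTerm n _ hk)
    (fun w => by
      rw [hW, ← Matrix.mulVec_mulVec]
      refine neg_le_dotProduct_gradient hIpd S w ?_
      have : I *ᵥ (expandMatrix α *ᵥ (influence α I *ᵥ S)) - S = (I * W - 1) *ᵥ S := by
        rw [Matrix.sub_mulVec, Matrix.one_mulVec, ← Matrix.mulVec_mulVec, hW,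
          ← Matrix.mulVec_mulVec]
      rw [this]
      exact hG ▸ (sum_abs_mulVec_le _ S).trans (mul_le_mul_of_nonneg_left hSK (nn _)))
    (fun k hk => by
      refine le_trans ?_ hfus
      have := hgapinit k
      rw [hk, sub_zero] at this
      have ha0 : 0 ≤ a := by linarith
      gcongr)
    (fun k hk => by
      obtain ⟨h₁, h₂, -⟩ := hfree k hk
      have h₃ : |gap α k| / 2 ≤ |gap (αinit n ω) k| := by
        have h₄ := hgapinit k
        rw [abs_sub_comm] at h₄
        have h₅ := abs_sub_abs_le_abs_sub (gap α k) (gap (αinit n ω) k)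
        have h₆ : K / √(n : ℝ) < |gap α k| / 2 := (div_lt_iff₀ hs).2 h₁
        linarith
      have h₄ : 0 < |gap (αinit n ω) k| := (half_pos (hgappos k hk)).trans_le h₃
      refine ⟨Real.rpow_pos_of_pos h₄ _, h₂.trans ?_⟩
      gcongr)
    (fun k hk => (hfree k hk).2.2) (by linarith) (by linarith) (hN ▸ hηt)
  rw [hlead]
  exact horacle.2 _ (hminω horacle.1)

end Main

section Limit

variable {p₀ p₁ : ℕ} {J₀₀ J₁₀ : Finset (Fin p₀)} {J₁₁ : Finset (Fin p₁)}
  {P : Measure (Obs p₀ p₁)} {α : Coef J₀₀ J₁₀ J₁₁ → ℝ}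

theorem integral_mulVec_mul_mulVec {E κ ι : Type*} [MeasurableSpace E] {Q : Measure E} [Fintype κ]
    {ξ : κ → E → ℝ} (hξ : ∀ c, MemLp (ξ c) 2 Q) (A : Matrix ι κ ℝ) :
    (Matrix.of fun a b => ∫ o, (A *ᵥ fun c => ξ c o) a * (A *ᵥ fun c => ξ c o) b ∂Q)
      = A * (Matrix.of fun c d => ∫ o, ξ c o * ξ d o ∂Q) * Aᵀ := by
  ext a b
  have hi : ∀ c d, Integrable (fun o => A a c * ξ c o * (A b d * ξ d o)) Q := fun c d =>
    ((hξ c).const_mul (A a c)).integrable_mul ((hξ d).const_mul (A b d))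
  have hl : ∀ o, (A *ᵥ fun c => ξ c o) a * (A *ᵥ fun c => ξ c o) b
      = ∑ c, ∑ d, A a c * ξ c o * (A b d * ξ d o) := fun o => Finset.sum_mul_sum ..
  simp only [Matrix.of_apply, hl, Matrix.mul_apply, Matrix.transpose_apply, Finset.sum_mul]
  rw [integral_finsetSum _ fun c _ => integrable_finsetSum _ fun d _ => hi c d, Finset.sum_comm]
  refine Finset.sum_congr rfl fun c _ => ?_
  rw [integral_finsetSum _ fun d _ => hi c d]
  refine Finset.sum_congr rfl fun d _ => ?_
  rw [show (fun o => A a c * ξ c o * (A b d * ξ d o)) = fun o => A a c * A b d * (ξ c o * ξ d o)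
    from funext fun o => by ring, integral_const_mul]
  ring

/-- The influence function of the estimator of the reduced parameter. -/
noncomputable def influenceFun (P : Measure (Obs p₀ p₁)) (α : Coef J₀₀ J₁₀ J₁₁ → ℝ)
    (r : Reduced α) (o : Obs p₀ p₁) : ℝ :=
  (influence α (fisherInfo P α) *ᵥ fun c => score o α c) r

theorem measurable_influenceFun (r : Reduced α) : Measurable (influenceFun P α r) :=
  Finset.measurable_sum _ fun c _ => (measurable_score α c).const_mul _

theorem memLp_influenceFun [IsProbabilityMeasure P] (hmodel : CorrectModel P α)
    (hfisher : FisherRegular P α) (r : Reduced α) : MemLp (influenceFun P α r) 2 P :=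
  memLp_finsetSum _ fun c _ => (memLp_score hmodel hfisher c).const_mul _

theorem integral_influenceFun [IsProbabilityMeasure P] (hmodel : CorrectModel P α)
    (hfisher : FisherRegular P α) (r : Reduced α) : ∫ o, influenceFun P α r o ∂P = 0 := by
  simp only [influenceFun, Matrix.mulVec, dotProduct]
  rw [integral_finsetSum _ fun c _ =>
    ((memLp_score hmodel hfisher c).integrable (by norm_num)).const_mul _]
  exact Finset.sum_eq_zero fun c _ => by
    rw [integral_const_mul, integral_score hmodel hfisher, mul_zero]

theorem asymptoticCov_eq_integral [IsProbabilityMeasure P] (hmodel : CorrectModel P α)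
    (hfisher : FisherRegular P α) :
    asymptoticCov P α
      = Matrix.of fun a b => ∫ o, influenceFun P α a o * influenceFun P α b o ∂P := by
  rw [asymptoticCov_eq P hfisher.2]
  exact (integral_mulVec_mul_mulVec (fun c => memLp_score hmodel hfisher c) _).symm

theorem leadingTerm_apply (n : ℕ) (x : ℕ → Obs p₀ p₁) (r : Reduced α) :
    leadingTerm P α n x r.1
      = (√(n : ℝ))⁻¹ * ∑ i ∈ Finset.range n, influenceFun P α r (x i) := by
  rw [leadingTerm, expandMatrix_mulVec_apply]
  simp only [influenceFun, Matrix.mulVec, dotProduct, normScore, Finset.mul_sum]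
  rw [Finset.sum_comm]
  exact Finset.sum_congr rfl fun i _ => Finset.sum_congr rfl fun c _ => by ring

theorem euclideanSpace_norm_lt {ι : Type*} [Fintype ι] {y : EuclideanSpace ℝ ι} {δ : ℝ}
    (hδ : 0 < δ) (h : ∀ a, |y a| ≤ δ) : ‖y‖ < δ * (Fintype.card ι + 1) := by
  have h0 : (0 : ℝ) ≤ Fintype.card ι := Nat.cast_nonneg _
  rw [EuclideanSpace.norm_eq, Real.sqrt_lt' (by positivity)]
  calc ∑ a, ‖y a‖ ^ 2 ≤ ∑ _a : ι, δ ^ 2 := by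
        gcongr with a
        exact h a
    _ = Fintype.card ι * δ ^ 2 := by rw [Finset.sum_const, Finset.card_univ, nsmul_eq_mul]
    _ < (δ * (Fintype.card ι + 1)) ^ 2 := by nlinarith [pow_pos hδ 2, mul_nonneg h0 h0]

end Limit

end FusedLasso

open FusedLasso

theorem mainTheorem1 {p₀ p₁ : ℕ} (J₀₀ J₁₀ : Finset (Fin p₀)) (J₁₁ : Finset (Fin p₁))
    (P : Measure (Obs p₀ p₁)) [IsProbabilityMeasure P]
    (αstar : Coef J₀₀ J₁₀ J₁₁ → ℝ)
    (hmodel : CorrectModel P αstar)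
    (hfisher : FisherRegular P αstar)
    (hthird : ThirdDerivDominated P αstar)
    {Ω : Type*} [MeasurableSpace Ω] (μ : Measure Ω) [IsProbabilityMeasure μ]
    (O : ℕ → Ω → Obs p₀ p₁) (hOmeas : ∀ i, Measurable (O i))
    (hOindep : iIndepFun O μ) (hOlaw : ∀ i, μ.map (O i) = P)
    (γ₁ : ℝ) (hγ : 0 < γ₁) (lam : ℕ → ℝ) (hlam : ∀ n, 0 ≤ lam n)
    (hlam₀ : Tendsto (fun n : ℕ => lam n / √(n : ℝ)) atTop (𝓝 0))
    (hlam₁ : Tendsto (fun n : ℕ => lam n * (n : ℝ) ^ ((γ₁ - 1) / 2)) atTop atTop)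
    (αinit : ℕ → Ω → Coef J₀₀ J₁₀ J₁₁ → ℝ) (hinit : ∀ n, AEMeasurable (αinit n) μ)
    (hinit₀ : ∀ k : ↥(J₀₀ ∩ J₁₀), IsSqrtConsistent μ
      (fun n ω => αinit n ω (common0 k)) (αstar (common0 k)))
    (hinit₁ : ∀ k : ↥(J₀₀ ∩ J₁₀), IsSqrtConsistent μ
      (fun n ω => αinit n ω (common1 k)) (αstar (common1 k)))
    (αhat : ℕ → Ω → Coef J₀₀ J₁₀ J₁₁ → ℝ) (hhat : ∀ n, AEMeasurable (αhat n) μ)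
    -- the estimator is a minimizer whenever the criterion has one
    (hmin : ∀ n, ∀ᵐ ω ∂μ,
      (∃ β, IsMinimizer (lam n) γ₁ n (fun i => O i ω) (αinit n ω) β) →
        IsMinimizer (lam n) γ₁ n (fun i => O i ω) (αinit n ω) (αhat n ω)) :
    Tendsto (fun n => μ {ω | fusedEdges (αhat n ω) = fusedEdges αstar}) atTop (𝓝 1) ∧
    Fintype.card (Reduced αstar) = numComponents αstar + 3 ∧
    (asymptoticCov P αstar).PosSemidef ∧
    TendstoInDistribution
      (fun (n : ℕ) ω => WithLp.toLp 2
        (fun r : Reduced αstar => √(n : ℝ) * (αhat n ω r.1 - αstar r.1)))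
      atTop (id : EuclideanSpace ℝ (Reduced αstar) → EuclideanSpace ℝ (Reduced αstar))
      (fun _ => μ)
      (multivariateGaussian (0 : EuclideanSpace ℝ (Reduced αstar)) (asymptoticCov P αstar)) := by
  have hbad : ∀ δ : ℝ, 0 < δ → Tendsto (fun n : ℕ => μ {ω | ¬ (‖√(n : ℝ) • (αhat n ω - αstar)
      - leadingTerm P αstar n (fun i => O i ω)‖ < δ ∧ fusedEdges (αhat n ω) = fusedEdges αstar)})
      atTop (𝓝 0) := fun δ hδ => by
    refine ENNReal.tendsto_nhds_zero.2 fun ε hε => ?_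
    exact eventually_measure_bad_le hmodel hfisher hthird hOmeas hOindep hOlaw hγ hlam₀ hlam₁
      hinit₀ hinit₁ hmin hδ hε
  have hcov := asymptoticCov_eq_integral hmodel hfisher
  refine ⟨?_, card_reduced αstar, ?_, ?_⟩
  · have hsub : Tendsto (fun n : ℕ => 1 - μ {ω | ¬ (‖√(n : ℝ) • (αhat n ω - αstar)
        - leadingTerm P αstar n (fun i => O i ω)‖ < 1
        ∧ fusedEdges (αhat n ω) = fusedEdges αstar)}) atTop (𝓝 1) := by
      simpa using ENNReal.Tendsto.sub (tendsto_const_nhds (x := (1 : ℝ≥0∞))) (hbad 1 one_pos)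
        (Or.inl ENNReal.one_ne_top)
    refine tendsto_of_tendsto_of_tendsto_of_le_of_le hsub tendsto_const_nhds (fun n => ?_)
      fun n => prob_le_one
    rw [tsub_le_iff_right, ← measure_univ (μ := μ)]
    refine le_trans (measure_mono fun ω _ => ?_) (measure_union_le _ _)
    by_cases h : fusedEdges (αhat n ω) = fusedEdges αstar
    · exact Or.inl h
    · exact Or.inr fun h' => h h'.2
  · rw [hcov]
    exact posSemidef_second_moment (memLp_influenceFun hmodel hfisher)
  · have hclt := tendstoInDistribution_multivariate hOmeas hOindep hOlaw
      (ξ := influenceFun P αstar) measurable_influenceFun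
      (memLp_influenceFun hmodel hfisher) (integral_influenceFun hmodel hfisher)
    simp only [← hcov] at hclt
    refine tendstoInDistribution_of_tendstoInMeasure_sub _ _ hclt ?_ fun n => ?_
    · rw [tendstoInMeasure_iff_norm]
      intro ε hε
      set N : ℝ := ((Fintype.card (Reduced αstar) : ℕ) : ℝ) with hN
      have hN0 : 0 ≤ N := Nat.cast_nonneg _
      have hδ : 0 < ε / (N + 1) := by positivity
      refine tendsto_of_tendsto_of_tendsto_of_le_of_le tendsto_const_nhds (hbad _ hδ)
        (fun _ => zero_le) fun n => measure_mono fun ω hω => ?_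
      rintro ⟨hlt, -⟩
      change ε ≤ _ at hω
      refine absurd hω (not_le.2 ?_)
      have := euclideanSpace_norm_lt (y := WithLp.toLp 2
        (fun r : Reduced αstar => √(n : ℝ) * (αhat n ω r.1 - αstar r.1))
        - WithLp.toLp 2 fun r : Reduced αstar =>
          (√(n : ℝ))⁻¹ * ∑ i ∈ Finset.range n, influenceFun P αstar r (O i ω)) hδ fun r => by
        have h₁ := (norm_le_pi_norm _ r.1).trans hlt.le
        rw [Pi.sub_apply, leadingTerm_apply] at h₁
        exact h₁
      rw [← hN, div_mul_cancel₀ _ (by positivity)] at this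
      simpa using this
    · refine (WithLp.measurable_toLp 2 _).comp_aemeasurable (aemeasurable_pi_lambda _ fun r => ?_)
      exact (((measurable_pi_apply r.1).comp_aemeasurable (hhat n)).sub_const _).const_mul _
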